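/- **Definitions.** All graphs are finite, simple and connected. $P_k$ is the path on $k$ nodes, and a graph is $P_k$-free if it does not contain $P_k$ as an induced subgraph. Let $\ell\ge 1$. In an $n$-node graph $G=(V,E)$ whose nodes carry pairwise distinct identifiers from a set $\{0,\dots,M-1\}$ with $M\ge n$, a certificate assignment of size $s$ gives each node $u$ a bit string $c(u)\in\{0,1\}^s$. The distance-$\ell$ view of $u$ consists of the identifier of $u$, the pairs $(\mathsf{id}(v),c(v))$ of all nodes $v$ at distance at most $\ell$ from $u$, and the edges of $G$ between these nodes (given by the identifiers of their endpoints). A proof-labeling scheme of locality $\ell$ and size $s$ (a $\mathsf{PLS}_\ell$ of size $s$) for $P_k$-freeness of $n$-node graphs is a function $\mathcal A$ from views to $\{\mathsf{Accept},\mathsf{Reject}\}$ (it may depend on $n$ and $M$) such that for every connected $n$-node graph $G$ with such identifiers: if $G$ is $P_k$-free, then for some certificate assignment of size $s$ every node outputs $\mathsf{Accept}$ on its view; if $G$ is not $P_k$-free, then for every certificate assignment of size $s$ at least one node outputs $\mathsf{Reject}$. **Theorem.** Let $\ell$, $d$ and $k$ be positive integers such that either $d\le 2$ and $k\ge 4d\ell+7d$,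 or $d\ge 3$ and $k\ge 4d\ell+4d$. Then every $\mathsf{PLS}_\ell$ for $P_k$-freeness requires certificates of size $\tilde\Omega(n^{2-1/d})$. That is, there are $C>0$, $a\in\mathbb N$ and $n_0$, depending only on $\ell,d,k$, such that for all $n\ge n_0$ and all $M\ge n$, every $\mathsf{PLS}_\ell$ for $P_k$-freeness of $n$-node graphs with identifiers from $\{0,\dots,M-1\}$ has size $$ s\;\ge\; C\,\frac{n^{2-1/d}}{(\log n)^a}. $$ -/

import Mathlib

/-- `G` is `P_k`-free: the path on `k` vertices is not an induced subgraph of `G`. -/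
def PathFree {V : Type} (k : ℕ) (G : SimpleGraph V) : Prop :=
  ¬ (SimpleGraph.pathGraph k).IsIndContained G

/-- A certificate of size `s`: a bit string of length `s`. -/
abbrev Certificate (s : ℕ) : Type := Fin s → Bool

/-- What a node may use in order to decide: its own identifier, the identifiers and certificates of
the nodes of its ball (its own certificate is the one listed next to its own identifier), and the
edges of the graph inside the ball, written as pairs of identifiers. -/
structure LocalView (s : ℕ) where
  center : ℕ
  labels : Set (ℕ × Certificate s)
  edges : Set (ℕ × ℕ)

/-- The ball of radius `ℓ` around `u`; `edist` is `⊤` between different components. -/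
def hopBall {V : Type} (G : SimpleGraph V) (ℓ : ℕ) (u : V) : Set V :=
  {v | G.edist u v ≤ (ℓ : ℕ∞)}

/-- The view at distance `ℓ` of the node `u` in `G`, under the identifiers `ident` and the
certificates `c`. -/
def localView {V : Type} {s : ℕ} (G : SimpleGraph V) (ident : V → ℕ) (c : V → Certificate s)
    (ℓ : ℕ) (u : V) : LocalView s where
  center := ident u
  labels := {p | ∃ v ∈ hopBall G ℓ u, p = (ident v, c v)}
  edges := {p | ∃ v ∈ hopBall G ℓ u, ∃ w ∈ hopBall G ℓ u, G.Adj v w ∧ p = (ident v, ident w)}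

/-- A verification algorithm, as a function from views to outputs; `true` means "accept". -/
abbrev Verifier (s : ℕ) : Type := LocalView s → Bool

/-- The verifier `A`, run with locality `ℓ` on certificates of size `s`, certifies the property `P`
on all connected graphs with `n` nodes and distinct identifiers from `{0, …, M - 1}`:
if `P G` holds, some certificate assignment is accepted by all nodes, and if it fails, every
certificate assignment is rejected by at least one node. -/
def Certifies (P : ∀ V : Type, SimpleGraph V → Prop) (ℓ n M s : ℕ) (A : Verifier s) : Prop :=
  ∀ (V : Type) [Fintype V] (G : SimpleGraph V) (ident : V → ℕ),
    Fintype.card V = n → G.Connected → Function.Injective ident → (∀ v, ident v < M) →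
      (P V G → ∃ c : V → Certificate s, ∀ u, A (localView G ident c ℓ u) = true) ∧
      (¬ P V G → ∀ c : V → Certificate s, ∃ u, A (localView G ident c ℓ u) = false)

/-- There is a proof-labeling scheme of locality `ℓ` and size `s` for `P`, on connected graphs with
`n` nodes and identifiers from `{0, …, M - 1}`. -/
def HasPLS (P : ∀ V : Type, SimpleGraph V → Prop) (ℓ n M s : ℕ) : Prop :=
  ∃ A : Verifier s, Certifies P ℓ n M s A

/-- Every proof-labeling scheme of locality `ℓ` for `P` has certificates of size `Ω̃(g n)`: up to a
constant factor and a power of `log n`, its size on `n`-node graphs is at least `g n` for all large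
`n`, for every identifier space that has room for `n` distinct identifiers. -/
def RequiresCertificateSize (P : ∀ V : Type, SimpleGraph V → Prop) (ℓ : ℕ) (g : ℕ → ℝ) : Prop :=
  ∃ C : ℝ, 0 < C ∧ ∃ a : ℕ, ∀ᶠ n : ℕ in Filter.atTop, ∀ M : ℕ, n ≤ M → ∀ s : ℕ,
    HasPLS P ℓ n M s → C * g n / Real.log n ^ a ≤ (s : ℝ)

/-! The bound comes from set disjointness. Over an alphabet of `q` digits, two inputs `x` and `y`
are sets of pairs of words of length `d`. They are encoded in a connected graph on at most `k * q ^
d` vertices, plus padding, that contains an induced `P_k` exactly when `x` and `y` share a pair.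
Only edges at the left end depend on `x`, and only edges at the right end depend on `y`. Each
position in between stores at most one digit, so the middle has at most `k * q` vertices, yet it is
too thick for a ball of radius `ℓ` to reach both ends. By a fooling argument (`card_le_of_hasPLS`),
the certificates of the middle determine `x`, whence `q ^ (2 * d) ≤ s * k * q`. Taking `n` of order
`q ^ d` gives `n ^ (2 - 1 / d)`, with no logarithmic loss.

In the graph every position carries a clique, and cliques at consecutive positions are completely
joined. A path taking one vertex per position is induced when no further edge joins its vertices.
Conflict edges then force equal digits on neighbouring layers, so each digit of each word travels
unchanged from left to right (`exists_common_pair`); the pairs absent from `x` or `y` are excluded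
by edges at the ends.

The main point is that every induced `P_k` has this shape. Blocks of two positions are cliques and a
block of one position is a single vertex (a hub), so a path meets a block in at most as many
vertices as it has positions. There are `k` positions in all, so equality holds in every block
(`card_block_eq`). Starting from the hub at position `0`, induction shows that the positions are
visited in order (`pos_eq_of_zero`). The danger is a shortcut through a conflict edge; the hubs of
the layout turn each one into a triangle or a vertex of degree three. -/

/-! ### Layouts and their graphs -/

/-- The role of a position: alone in its block, or first or second in a block of two. -/
inductive Kind
  | single
  | first
  | second

/-- A sequence of `k` positions, cut into blocks of one or two consecutive positions. The position
`p` stores the digits `τ` with `mask p τ` of a word, which is the first or the second word of a pair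
according to `typ p`; `lam p` is a coordinate between the two sides of the graph. The words are
stored in full at `a`, `a + 2` (left side) and at `b`, `b + 2` (right side). -/
structure Layout (k d m : ℕ) where
  kind : ℕ → Kind
  typ : ℕ → Bool
  lam : ℕ → ℕ
  mask : ℕ → ℕ → Prop
  a : ℕ
  b : ℕ
  kind_zero : kind 0 = .single
  one_lt : 1 < k
  first_succ : ∀ p < k, kind p = .first → kind (p + 1) = .second
  second_pred : ∀ p < k, kind (p + 1) = .second → kind p = .first
  second_lt : ∀ p < k, kind p = .second → p + 1 < k
  first_lt : ∀ p < k, kind p = .first → p + 1 < k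
  mask_single : ∀ p < k, kind p = .single → ∀ τ, ¬ mask p τ
  kind_a : kind a = .first
  kind_b : kind b = .second
  kind_b_add : kind (b + 3) = .single
  b_lt : b + 3 < k
  a_lt : a + 2 < k
  -- A long shortcut from `j` to `p` lands next to a hub, which gives the landing vertex a third
  -- neighbour on the path.
  guarded : ∀ j p, j + 2 < p → p < k → kind j = .second → kind (j + 1) = .first → typ j = typ p →
    lam j ≤ lam p + 1 → lam p ≤ lam j + 1 → (∃ τ, mask j τ ∧ mask p τ) →
    (1 ≤ p ∧ kind (p - 1) = .single) ∨ (p + 1 < k ∧ kind (p + 1) = .single)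
  -- This excludes the shortcut from `j` to `j + 2`, the second position of the next block. Either a
  -- hub lies just after the following block, or the digit stored at `j + 2` is compared again at `j
  -- + 4`.
  stable : ∀ j, j + 4 < k → kind j = .second → kind (j + 1) = .first → typ j = typ (j + 2) →
    lam j ≤ lam (j + 2) + 1 → lam (j + 2) ≤ lam j + 1 → (∃ τ, mask j τ ∧ mask (j + 2) τ) →
    kind (j + 3) = .first →
    (j + 5 < k ∧ kind (j + 5) = .single) ∨
    (j + 2 ≠ a ∧ ∃ τ, (∀ τ', mask (j + 2) τ' → τ' = τ) ∧ mask (j + 4) τ ∧ typ (j + 2) = typ (j + 4) ∧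
      lam (j + 2) ≤ lam (j + 4) + 1 ∧ lam (j + 4) ≤ lam (j + 2) + 1)
  -- Members of a chain have the same type, so they are never at consecutive positions and equality
  -- of their digits can be read off from non-adjacency.
  alternate : ∀ p, p + 1 < k → ∀ τ τ', mask p τ → mask (p + 1) τ' → typ p ≠ typ (p + 1)
  chain : ∀ τ < d, ∀ t : Bool, ∃ c : ℕ → ℕ, c 0 = (if t then a + 2 else a) ∧
    c (m + 1) = (if t then b + 2 else b) ∧
    ∀ i ≤ m + 1, c i < k ∧ mask (c i) τ ∧ typ (c i) = t ∧ lam (c i) = i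

namespace Layout

variable {k d m : ℕ} (Λ : Layout k d m) {V : Type}

/-- Two vertices on nearby layers store different values of the same digit. -/
def Conflict (pos : V → ℕ) (lab : V → ℕ → ℕ) (u v : V) : Prop :=
  Λ.typ (pos u) = Λ.typ (pos v) ∧ Λ.lam (pos u) ≤ Λ.lam (pos v) + 1 ∧
    Λ.lam (pos v) ≤ Λ.lam (pos u) + 1 ∧
    ∃ τ, Λ.mask (pos u) τ ∧ Λ.mask (pos v) τ ∧ lab u τ ≠ lab v τ

/-- The two vertices store in full the two words of a pair, on the same side, and the pair is not
allowed there. -/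
def Forbidden (pos : V → ℕ) (X Y : V → V → Prop) (u v : V) : Prop :=
  (pos u = Λ.a ∧ pos v = Λ.a + 2 ∧ ¬ X u v) ∨ (pos u = Λ.b ∧ pos v = Λ.b + 2 ∧ ¬ Y u v)

/-- The graph of a layout: vertices at the same or at consecutive positions are adjacent, and so are
conflicting vertices and the pairs excluded by `X` and `Y`. -/
def graph (pos : V → ℕ) (lab : V → ℕ → ℕ) (X Y : V → V → Prop) : SimpleGraph V where
  Adj u v := u ≠ v ∧ (pos u = pos v ∨ pos u + 1 = pos v ∨ pos v + 1 = pos u ∨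
    Λ.Conflict pos lab u v ∨ Λ.Forbidden pos X Y u v ∨ Λ.Forbidden pos X Y v u)
  symm := ⟨by
    rintro u v ⟨h, h'⟩
    refine ⟨h.symm, ?_⟩
    rcases h' with h' | h' | h' | ⟨h1, h2, h3, τ, h4, h5, h6⟩ | h' | h'
    · exact .inl h'.symm
    · exact .inr (.inr (.inl h'))
    · exact .inr (.inl h')
    · exact .inr (.inr (.inr (.inl ⟨h1.symm, h3, h2, τ, h5, h4, h6.symm⟩)))
    · exact .inr (.inr (.inr (.inr (.inr h'))))
    · exact .inr (.inr (.inr (.inr (.inl h'))))⟩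
  loopless := ⟨fun _ h => h.1 rfl⟩

end Layout

/-! ### Induced paths -/

/-- Two maps on `Fin k` whose fibres compare have fibres of the same sizes. -/
lemma card_fiber_eq_of_le {k : ℕ} (f g : Fin k → ℕ)
    (h : ∀ c, (Finset.univ.filter fun i => f i = c).card ≤
      (Finset.univ.filter fun i => g i = c).card) (c : ℕ) :
    (Finset.univ.filter fun i => f i = c).card = (Finset.univ.filter fun i => g i = c).card := by
  classical
  set S := insert c (Finset.univ.image f ∪ Finset.univ.image g) with hS
  have hf : (Finset.univ : Finset (Fin k)).card =
      ∑ c ∈ S, (Finset.univ.filter fun i => f i = c).card :=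
    Finset.card_eq_sum_card_fiberwise fun i _ => by simp [hS]
  have hg : (Finset.univ : Finset (Fin k)).card =
      ∑ c ∈ S, (Finset.univ.filter fun i => g i = c).card :=
    Finset.card_eq_sum_card_fiberwise fun i _ => by simp [hS]
  -- Both families of fibre sizes sum to `k` over `S`, so termwise inequalities are equalities.
  exact (Finset.sum_eq_sum_iff_of_le fun c _ => h c).1 (hf.symm.trans hg) c (by simp [hS])

/-- `f` lists the vertices of an induced path with `k` vertices of `G`. -/
structure IsInducedPath {V : Type} (G : SimpleGraph V) (k : ℕ) (f : ℕ → V) : Prop where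
  inj : ∀ i < k, ∀ j < k, f i = f j → i = j
  adj : ∀ i < k, ∀ j < k, (G.Adj (f i) (f j) ↔ i + 1 = j ∨ j + 1 = i)

namespace IsInducedPath

variable {V : Type} {G : SimpleGraph V} {k : ℕ} {f : ℕ → V}

lemma reverse (hf : IsInducedPath G k f) : IsInducedPath G k (fun i => f (k - 1 - i)) where
  inj i hi j hj h := by
    have := hf.inj _ (by omega) _ (by omega) h
    omega
  adj i hi j hj := by
    rw [hf.adj _ (by omega) _ (by omega)]
    omega

lemma triangle_free (hf : IsInducedPath G k f) {i j l : ℕ} (hi : i < k) (hj : j < k) (hl : l < k)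
    (h1 : G.Adj (f i) (f j)) (h2 : G.Adj (f i) (f l)) (h3 : G.Adj (f j) (f l)) : False := by
  rw [hf.adj _ hi _ hj] at h1
  rw [hf.adj _ hi _ hl] at h2
  rw [hf.adj _ hj _ hl] at h3
  omega

lemma claw_free (hf : IsInducedPath G k f) {c i j l : ℕ} (hc : c < k) (hi : i < k) (hj : j < k)
    (hl : l < k) (hij : i ≠ j) (hil : i ≠ l) (hjl : j ≠ l)
    (h1 : G.Adj (f c) (f i)) (h2 : G.Adj (f c) (f j)) (h3 : G.Adj (f c) (f l)) : False := by
  rw [hf.adj _ hc _ hi] at h1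
  rw [hf.adj _ hc _ hj] at h2
  rw [hf.adj _ hc _ hl] at h3
  omega

lemma ne (hf : IsInducedPath G k f) {i j : ℕ} (hi : i < k) (hj : j < k) (h : i ≠ j) : f i ≠ f j :=
  fun e => h (hf.inj i hi j hj e)

end IsInducedPath

/-! ### An induced path on `k` vertices visits the positions in order -/

namespace Layout

section Forced

variable {k d m : ℕ} (Λ : Layout k d m) {V : Type} {pos : V → ℕ} {lab : V → ℕ → ℕ}
  {X Y : V → V → Prop}

/-- The block of a position, named after its first element. -/
def block (p : ℕ) : ℕ :=
  match Λ.kind p with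
  | .second => p - 1
  | _ => p

variable {Λ}

lemma adj_of_pos_eq {u v : V} (h : u ≠ v) (hp : pos u = pos v) :
    (Λ.graph pos lab X Y).Adj u v := ⟨h, .inl hp⟩

lemma adj_of_pos_succ {u v : V} (hp : pos u + 1 = pos v) :
    (Λ.graph pos lab X Y).Adj u v :=
  ⟨by rintro rfl; omega, .inr (.inl hp)⟩

lemma adj_of_pair {u v : V} {p : ℕ} (h : u ≠ v) (hu : pos u = p ∨ pos u = p + 1)
    (hv : pos v = p ∨ pos v = p + 1) : (Λ.graph pos lab X Y).Adj u v :=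
  ⟨h, by omega⟩

lemma block_of_single {p : ℕ} (h : Λ.kind p = .single) : Λ.block p = p := by simp [block, h]
lemma block_of_first {p : ℕ} (h : Λ.kind p = .first) : Λ.block p = p := by simp [block, h]
lemma block_of_second {p : ℕ} (h : Λ.kind p = .second) : Λ.block p = p - 1 := by simp [block, h]

lemma pos_of_second {p : ℕ} (h : Λ.kind p = .second) : 1 ≤ p := by
  rcases p with _ | p
  · rw [Λ.kind_zero] at h; cases h
  · omega

lemma pred_first {p : ℕ} (hp : p < k) (h : Λ.kind p = .second) :
    ∃ r, p = r + 1 ∧ Λ.kind r = .first := by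
  obtain ⟨r, rfl⟩ : ∃ r, p = r + 1 := ⟨p - 1, by have := pos_of_second h; omega⟩
  exact ⟨r, rfl, Λ.second_pred r (by omega) h⟩

lemma block_eq_single {p r : ℕ} (hp : p < k) (hr : r < k) (h : Λ.kind p = .single)
    (hb : Λ.block r = p) : r = p := by
  rcases hk : Λ.kind r with _ | _ | _
  · rwa [block_of_single hk] at hb
  · rwa [block_of_first hk] at hb
  · obtain ⟨r, rfl, h'⟩ := pred_first hr hk
    rw [block_of_second hk] at hb
    simp at hb
    subst hb
    rw [h] at h'; cases h'

lemma block_eq_first {p r : ℕ} (hr : r < k) (hb : Λ.block r = p) : r = p ∨ r = p + 1 := by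
  rcases hk : Λ.kind r with _ | _ | _
  · rw [block_of_single hk] at hb; exact .inl hb
  · rw [block_of_first hk] at hb; exact .inl hb
  · obtain ⟨r, rfl, h'⟩ := pred_first hr hk
    rw [block_of_second hk] at hb
    simp at hb
    omega

variable (hpos : ∀ v, pos v < k)
  (hlab : ∀ u v, pos u = pos v → pos u ≠ Λ.a → u ≠ v →
    ∃ τ, Λ.mask (pos u) τ ∧ lab u τ ≠ lab v τ)
include hpos hlab

lemma eq_of_single {u v : V} (h : pos u = pos v) (hk : Λ.kind (pos u) = .single) : u = v := by
  by_contra hne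
  obtain ⟨τ, h1, -⟩ := hlab u v h (by
    intro e; rw [e, Λ.kind_a] at hk; cases hk) hne
  exact Λ.mask_single _ (hpos u) hk τ h1

variable {f : ℕ → V} (hf : IsInducedPath (Λ.graph pos lab X Y) k f)
include hf

/-- A block of two positions is a clique, so three path vertices in it would form a triangle; a
block of one position is a single vertex. Hence the path meets each block in at most its size, and
the total `k` leaves no slack. -/
lemma card_block_eq (c : ℕ) :
    (Finset.univ.filter fun i : Fin k => Λ.block (pos (f i)) = c).card =
      (Finset.univ.filter fun i : Fin k => Λ.block i = c).card := by
  refine card_fiber_eq_of_le (fun i : Fin k => Λ.block (pos (f i)))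
    (fun i : Fin k => Λ.block i) (fun c => ?_) c
  rcases (Finset.univ.filter fun i : Fin k => Λ.block (pos (f i)) = c).eq_empty_or_nonempty
    with h0 | ⟨i, hi⟩
  · rw [h0]; simp
  simp only [Finset.mem_filter, Finset.mem_univ, true_and] at hi
  have hpair : ∀ p, Λ.kind p = .first → p + 1 < k → Λ.block p = c →
      (Finset.univ.filter fun i : Fin k => Λ.block (pos (f i)) = c).card ≤
      (Finset.univ.filter fun i : Fin k => Λ.block i = c).card := by
    intro p hk hp hc
    rw [block_of_first hk] at hc
    subst hc
    have h2 : 2 ≤ (Finset.univ.filter fun i : Fin k => Λ.block i = p).card := by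
      have : ({⟨p, by omega⟩, ⟨p + 1, hp⟩} : Finset (Fin k)) ⊆
          Finset.univ.filter fun i : Fin k => Λ.block i = p := by
        intro x hx
        simp only [Finset.mem_insert, Finset.mem_singleton] at hx
        simp only [Finset.mem_filter, Finset.mem_univ, true_and]
        rcases hx with rfl | rfl
        · exact block_of_first hk
        · exact block_of_second (Λ.first_succ p (by omega) hk)
      refine le_trans ?_ (Finset.card_le_card this)
      rw [Finset.card_pair]
      simp
    refine le_trans ?_ h2
    by_contra hlt
    push Not at hlt
    obtain ⟨x, y, z, hx, hy, hz, hxy, hxz, hyz⟩ := Finset.two_lt_card_iff.1 hlt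
    simp only [Finset.mem_filter, Finset.mem_univ, true_and] at hx hy hz
    have key : ∀ x y : Fin k, x ≠ y → Λ.block (pos (f x)) = p → Λ.block (pos (f y)) = p →
        (Λ.graph pos lab X Y).Adj (f x) (f y) := fun x y hxy hx hy =>
      adj_of_pair (hf.ne x.2 y.2 (by simpa [Fin.ext_iff] using hxy))
        (block_eq_first (hpos _) hx) (block_eq_first (hpos _) hy)
    exact hf.triangle_free x.2 y.2 z.2 (key x y hxy hx hy) (key x z hxz hx hz) (key y z hyz hy hz)
  rcases hk : Λ.kind (pos (f i)) with _ | _ | _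
  · have hc := block_of_single hk
    rw [hi] at hc
    have h1 : 1 ≤ (Finset.univ.filter fun i : Fin k => Λ.block i = c).card := by
      rw [Nat.one_le_iff_ne_zero, Finset.card_ne_zero]
      exact ⟨⟨pos (f i), hpos _⟩, by simpa using hi⟩
    refine le_trans ?_ h1
    rw [Finset.card_le_one]
    intro x hx y hy
    simp only [Finset.mem_filter, Finset.mem_univ, true_and] at hx hy
    rw [← hc] at hk
    have hx' := block_eq_single (hc ▸ hpos _) (hpos _) hk hx
    have hy' := block_eq_single (hc ▸ hpos _) (hpos _) hk hy
    exact Fin.ext (hf.inj _ x.2 _ y.2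
      (eq_of_single hpos hlab (hx'.trans hy'.symm) (by rw [hx']; exact hk)))
  · exact hpair _ hk (Λ.first_lt _ (hpos _) hk) hi
  · obtain ⟨r, hr, h'⟩ := pred_first (hpos _) hk
    refine hpair r h' (hr ▸ hpos _) ?_
    rw [block_of_first h', ← hi, block_of_second hk, hr]
    simp

lemma exists_of_single {p : ℕ} (hp : p < k) (hk : Λ.kind p = .single) :
    ∃ i < k, pos (f i) = p := by
  have h := card_block_eq hpos hlab hf p
  have h1 : 0 < (Finset.univ.filter fun i : Fin k => Λ.block i = p).card := by
    rw [Finset.card_pos]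
    exact ⟨⟨p, hp⟩, by simpa using block_of_single hk⟩
  rw [← h, Finset.card_pos] at h1
  obtain ⟨i, hi⟩ := h1
  exact ⟨i, i.2, block_eq_single hp (hpos _) hk (by simpa using hi)⟩

lemma exists_of_first {p : ℕ} (hp : p < k) (hk : Λ.kind p = .first) :
    ∃ i < k, ∃ j < k, i ≠ j ∧ (pos (f i) = p ∨ pos (f i) = p + 1) ∧
      (pos (f j) = p ∨ pos (f j) = p + 1) := by
  have hp1 := Λ.first_lt p hp hk
  have h := card_block_eq hpos hlab hf p
  have h1 : 1 < (Finset.univ.filter fun i : Fin k => Λ.block i = p).card := by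
    rw [Finset.one_lt_card]
    refine ⟨⟨p, hp⟩, by simpa using block_of_first hk, ⟨p + 1, hp1⟩, ?_, by simp⟩
    simpa using block_of_second (Λ.first_succ p hp hk)
  rw [← h, Finset.one_lt_card] at h1
  obtain ⟨i, hi, j, hj, hij⟩ := h1
  exact ⟨i, i.2, j, j.2, by simpa [Fin.ext_iff] using hij,
    block_eq_first (hpos _) (by simpa using hi), block_eq_first (hpos _) (by simpa using hj)⟩

/-- A vertex of the path has a mate in its block of two. -/
lemma exists_mate {i p : ℕ} (hi : i < k) (hp : p < k) (hk : Λ.kind p = .first)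
    (h : pos (f i) = p ∨ pos (f i) = p + 1) :
    ∃ j < k, j ≠ i ∧ (pos (f j) = p ∨ pos (f j) = p + 1) ∧
      (Λ.graph pos lab X Y).Adj (f i) (f j) := by
  obtain ⟨u, hu, v, hv, huv, hu', hv'⟩ := exists_of_first hpos hlab hf hp hk
  by_cases hui : u = i
  · subst hui
    exact ⟨v, hv, huv.symm, hv', adj_of_pair (hf.ne hu hv huv) hu' hv'⟩
  · exact ⟨u, hu, hui, hu', adj_of_pair (hf.ne hi hu (Ne.symm hui)) h hu'⟩

lemma pos_succ_of_single {j : ℕ} (hj : j + 1 < k) (ih : ∀ i ≤ j, pos (f i) = i)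
    (hk : Λ.kind (j + 1) = .single) : pos (f (j + 1)) = j + 1 := by
  obtain ⟨i, hi, hp⟩ := exists_of_single hpos hlab hf hj hk
  have hadj : (Λ.graph pos lab X Y).Adj (f j) (f i) :=
    adj_of_pos_succ (by rw [ih j le_rfl, hp])
  rw [hf.adj _ (by omega) _ hi] at hadj
  rcases hadj with rfl | h
  · exact hp
  · have := ih i (by omega); omega

/-- The second path vertex in the block of `f j` is adjacent to `f j`, so it is `f (j + 1)`. At
position `j` it would also be adjacent to `f (j - 1)`. -/
lemma pos_succ_of_second {j : ℕ} (hj : j + 1 < k) (ih : ∀ i ≤ j, pos (f i) = i)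
    (hk : Λ.kind (j + 1) = .second) : pos (f (j + 1)) = j + 1 := by
  have hj1 := Λ.second_pred j (by omega) hk
  have hj0 : 1 ≤ j := by
    rcases j with _ | j
    · rw [Λ.kind_zero] at hj1; cases hj1
    · omega
  obtain ⟨i, hi, hne, hp, hadj⟩ := exists_mate hpos hlab hf (i := j) (by omega) (by omega) hj1
    (.inl (ih j le_rfl))
  rw [hf.adj _ (by omega) _ hi] at hadj
  rcases hadj with rfl | h
  · rcases hp with hp | hp
    · exfalso
      have h1 : (Λ.graph pos lab X Y).Adj (f (j - 1)) (f (j + 1)) :=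
        adj_of_pos_succ (by rw [ih (j - 1) (by omega), hp]; omega)
      rw [hf.adj _ (by omega) _ hi] at h1
      omega
    · exact hp
  · have := ih i (by omega); omega

/-- The blocks met so far are already full: another vertex in one of them would repeat a hub or
complete a triangle. -/
lemma lt_pos_of_first {j : ℕ} (hj : j + 1 < k) (ih : ∀ i ≤ j, pos (f i) = i)
    (hk : Λ.kind (j + 1) = .first) : j < pos (f (j + 1)) := by
  by_contra hle
  push Not at hle
  set p := pos (f (j + 1)) with hp
  rcases hkp : Λ.kind p with _ | _ | _
  · have := eq_of_single hpos hlab (u := f p) (v := f (j + 1)) (by rw [ih p hle])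
      (by rwa [ih p hle])
    have := hf.inj _ (by omega) _ hj this
    omega
  · have hs := Λ.first_succ p (by omega) hkp
    have hpj : p + 1 ≤ j := by
      rcases Nat.lt_or_ge p j with h | h
      · exact h
      · have e : p = j := by omega
        rw [e, hk] at hs; cases hs
    refine hf.triangle_free (i := p) (j := p + 1) (l := j + 1) (by omega) (by omega) hj ?_ ?_ ?_
    · exact adj_of_pair (p := p) (hf.ne (by omega) (by omega) (by omega)) (.inl (ih p hle))
        (.inr (ih _ hpj))
    · exact adj_of_pair (p := p) (hf.ne (by omega) (by omega) (by omega)) (.inl (ih p hle))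
        (.inl hp.symm)
    · exact adj_of_pair (p := p) (hf.ne (by omega) (by omega) (by omega)) (.inr (ih _ hpj))
        (.inl hp.symm)
  · obtain ⟨r, hr, hkr⟩ := pred_first (by omega) hkp
    have hrj : r ≤ j := by omega
    refine hf.triangle_free (i := r) (j := p) (l := j + 1) (by omega) (by omega) hj ?_ ?_ ?_
    · exact adj_of_pair (p := r) (hf.ne (by omega) (by omega) (by omega)) (.inl (ih r hrj))
        (.inr (by rw [ih p hle, hr]))
    · exact adj_of_pair (p := r) (hf.ne (by omega) (by omega) (by omega)) (.inl (ih r hrj))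
        (.inr (by rw [← hp, hr]))
    · exact adj_of_pair (p := r) (hf.ne (by omega) (by omega) (by omega))
        (.inr (by rw [ih p hle, hr])) (.inr (by rw [← hp, hr]))

/-- The path cannot leave a block of two towards the second element of the next block. -/
lemma not_skip {j : ℕ} (hj : j + 1 < k) (ih : ∀ i ≤ j, pos (f i) = i)
    (hkj : Λ.kind j = .second) (hk : Λ.kind (j + 1) = .first)
    (hp : pos (f (j + 1)) = j + 2) : False := by
  have hj2 : j + 2 < k := Λ.first_lt _ hj hk
  have hk2 : Λ.kind (j + 2) = .second := Λ.first_succ _ hj hk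
  have hj3 : j + 3 < k := Λ.second_lt _ hj2 hk2
  have hadj0 : (Λ.graph pos lab X Y).Adj (f j) (f (j + 1)) := by
    rw [hf.adj _ (by omega) _ hj]; omega
  obtain ⟨i, hi, hne, hpi, hadj⟩ := exists_mate hpos hlab hf hj hj hk (.inr hp)
  rw [hf.adj _ hj _ hi] at hadj
  -- The mate of `f (j + 1)` is its other neighbour on the path, and it lies at `j + 2` too, since a
  -- vertex at `j + 1` would be adjacent to `f j`.
  obtain rfl : i = j + 2 := by
    rcases hadj with h | h
    · omega
    · obtain rfl : i = j := by omega
      have := ih i le_rfl; omega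
  have hpi : pos (f (j + 2)) = j + 2 := by
    rcases hpi with h | h
    · exfalso
      have h1 : (Λ.graph pos lab X Y).Adj (f j) (f (j + 2)) :=
        adj_of_pos_succ (by rw [ih j le_rfl, h])
      rw [hf.adj _ (by omega) _ hi] at h1
      omega
    · exact h
  have no3 : ∀ i < k, pos (f i) ≠ j + 3 := by
    intro i hi h
    refine hf.triangle_free (i := j + 1) (j := j + 2) (l := i) hj hj2 hi ?_ ?_ ?_
    · exact adj_of_pos_eq (hf.ne hj hj2 (by omega)) (by omega)
    · exact adj_of_pos_succ (by omega)
    · exact adj_of_pos_succ (by omega)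
  have hk3 : Λ.kind (j + 3) = .first := by
    rcases hk3 : Λ.kind (j + 3) with _ | _ | _
    · obtain ⟨i, hi, h⟩ := exists_of_single hpos hlab hf hj3 hk3
      exact absurd h (no3 i hi)
    · rfl
    · have := Λ.second_pred (j + 2) hj2 hk3
      rw [hk2] at this; cases this
  have hj4 : j + 4 < k := Λ.first_lt _ hj3 hk3
  obtain ⟨u, hu, v, hv, huv, hpu, hpv⟩ := exists_of_first hpos hlab hf hj3 hk3
  replace hpu : pos (f u) = j + 4 := hpu.resolve_left (no3 u hu)
  replace hpv : pos (f v) = j + 4 := hpv.resolve_left (no3 v hv)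
  have huv' : (Λ.graph pos lab X Y).Adj (f u) (f v) :=
    adj_of_pos_eq (hf.ne hu hv huv) (hpu.trans hpv.symm)
  -- Only a forbidden pair at `b` could compete with a conflict here, and then `b + 3` would be a
  -- hub.
  have hconf : Λ.Conflict pos lab (f j) (f (j + 1)) := by
    have hpj := ih j le_rfl
    have hja : j ≠ Λ.a := by rintro rfl; rw [Λ.kind_a] at hkj; cases hkj
    have hjb : j ≠ Λ.b := by rintro rfl; rw [Λ.kind_b_add] at hk3; cases hk3
    rcases hadj0.2 with h | h | h | h | h | h
    · omega
    · omega
    · omega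
    · exact h
    · rcases h with h | h <;> omega
    · rcases h with h | h <;> omega
  obtain ⟨c1, c2, c3, τ, c4, c5, -⟩ := hconf
  rw [ih j le_rfl, hp] at c1 c2 c3
  rw [ih j le_rfl] at c4
  rw [hp] at c5
  rcases Λ.stable j hj4 hkj hk c1 c2 c3 ⟨τ, c4, c5⟩ hk3 with ⟨h5, hk5⟩ | ⟨hna, σ, s1, s2, s3, s4, s5⟩
  · obtain ⟨i, hi, h⟩ := exists_of_single hpos hlab hf h5 hk5
    exact hf.triangle_free hu hv hi huv' (adj_of_pos_succ (by omega)) (adj_of_pos_succ (by omega))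
  · obtain ⟨τ', t1, t2⟩ := hlab (f (j + 1)) (f (j + 2)) (by omega) (by omega)
      (hf.ne hj hj2 (by omega))
    rw [hp] at t1
    have e' := s1 τ' t1
    subst e'
    -- `f (j + 1)` and `f (j + 2)` differ in their only digit. A path vertex at `j + 4` is not
    -- adjacent to the former, so it shares its digit and conflicts with the latter. Both `u` and
    -- `v` do so, which closes a triangle.
    have key : ∀ u < k, pos (f u) = j + 4 → (Λ.graph pos lab X Y).Adj (f (j + 2)) (f u) := by
      intro u hu hpu
      have h1 : lab (f (j + 1)) τ' = lab (f u) τ' := by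
        by_contra hne
        have : (Λ.graph pos lab X Y).Adj (f (j + 1)) (f u) := by
          refine ⟨by intro e; rw [← e] at hpu; omega, .inr (.inr (.inr (.inl ?_)))⟩
          rw [Conflict, hp, hpu]
          exact ⟨s3, s4, s5, τ', t1, s2, hne⟩
        rw [hf.adj _ hj _ hu] at this
        rcases this with h | h
        · obtain rfl : u = j + 2 := by omega
          omega
        · obtain rfl : u = j := by omega
          have := ih u le_rfl; omega
      refine ⟨by intro e; rw [← e] at hpu; omega, .inr (.inr (.inr (.inl ?_)))⟩
      rw [Conflict, hpi, hpu]
      exact ⟨s3, s4, s5, τ', t1, s2, by rw [← h1]; exact t2.symm⟩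
    have a1 := key u hu hpu
    have a2 := key v hv hpv
    exact hf.triangle_free hj2 hu hv a1 a2 huv'

/-- Earlier positions are full and `j + 2` is excluded by `not_skip`. A jump beyond `j + 2` uses a
conflict edge, and then `f (j + 1)` has three neighbours on the path: `f j`, its mate and a hub. -/
lemma pos_succ_of_first {j : ℕ} (hj : j + 1 < k) (ih : ∀ i ≤ j, pos (f i) = i)
    (hk : Λ.kind (j + 1) = .first) : pos (f (j + 1)) = j + 1 := by
  have hlt := lt_pos_of_first hpos hlab hf hj ih hk
  have hadj : (Λ.graph pos lab X Y).Adj (f j) (f (j + 1)) := by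
    rw [hf.adj _ (by omega) _ hj]; omega
  have hpj := ih j le_rfl
  have hkf : Λ.kind j ≠ .first := by
    intro h
    have := Λ.first_succ j (by omega) h
    rw [hk] at this; cases this
  by_contra hne
  have hp2 := hpos (f (j + 1))
  set p := pos (f (j + 1)) with hp
  by_cases hs : Λ.kind j = .second
  · have hp3 : p ≠ j + 2 := fun h => not_skip hpos hlab hf hj ih hs hk (by omega)
    have hja : j ≠ Λ.a := by rintro rfl; rw [Λ.kind_a] at hs; cases hs
    have hconf : Λ.Conflict pos lab (f j) (f (j + 1)) := by
      rcases hadj.2 with h | h | h | h | h | h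
      · omega
      · omega
      · omega
      · exact h
      · rcases h with h | h <;> omega
      · rcases h with h | h <;> omega
    obtain ⟨c1, c2, c3, τ, c4, c5, -⟩ := hconf
    rw [hpj, ← hp] at c1 c2 c3
    rw [hpj] at c4
    rw [← hp] at c5
    have hmate : ∃ i < k, i ≠ j ∧ pos (f i) ≠ j ∧ Λ.kind (pos (f i)) ≠ .single ∧
        (Λ.graph pos lab X Y).Adj (f (j + 1)) (f i) := by
      rcases hkp : Λ.kind p with _ | _ | _
      · exact absurd c5 (Λ.mask_single p (by omega) hkp τ)
      · obtain ⟨i, hi, hne, hpi, ha⟩ := exists_mate hpos hlab hf hj (by omega) hkp (.inl hp.symm)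
        refine ⟨i, hi, by rintro rfl; omega, by omega, ?_, ha⟩
        rcases hpi with h | h
        · rw [h, hkp]; simp
        · rw [h, Λ.first_succ p (by omega) hkp]; simp
      · obtain ⟨r, hr, hkr⟩ := pred_first (by omega) hkp
        obtain ⟨i, hi, hne, hpi, ha⟩ := exists_mate hpos hlab hf hj (p := r) (by omega) hkr
          (.inr (by omega))
        refine ⟨i, hi, by rintro rfl; omega, by omega, ?_, ha⟩
        rcases hpi with h | h
        · rw [h, hkr]; simp
        · rw [h, ← hr, hkp]; simp
    obtain ⟨i, hi, hij, hpi, hki, ha⟩ := hmate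
    obtain ⟨l, hl, hkl, hpl, hal⟩ : ∃ l < k, Λ.kind (pos (f l)) = .single ∧ pos (f l) ≠ j ∧
        (Λ.graph pos lab X Y).Adj (f (j + 1)) (f l) := by
      rcases Λ.guarded j p (by omega) (by omega) hs hk c1 c2 c3 ⟨τ, c4, c5⟩ with ⟨h1, h2⟩ | ⟨h1, h2⟩
      · obtain ⟨l, hl, hpl⟩ := exists_of_single hpos hlab hf (by omega) h2
        exact ⟨l, hl, by rw [hpl]; exact h2, by omega, (adj_of_pos_succ (by omega)).symm⟩
      · obtain ⟨l, hl, hpl⟩ := exists_of_single hpos hlab hf h1 h2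
        exact ⟨l, hl, by rw [hpl]; exact h2, by omega, adj_of_pos_succ (by omega)⟩
    refine hf.claw_free (c := j + 1) (i := j) (j := i) (l := l) hj (by omega) hi hl
      (Ne.symm hij) ?_ ?_ hadj.symm ha hal
    · rintro rfl; exact hpl hpj
    · rintro rfl; exact hki hkl
  · have hs' : Λ.kind j = .single := by
      rcases h : Λ.kind j with _ | _ | _
      · rfl
      · exact absurd h hkf
      · exact absurd h hs
    have hja : j ≠ Λ.a := by rintro rfl; rw [Λ.kind_a] at hs'; cases hs'
    have hjb : j ≠ Λ.b := by rintro rfl; rw [Λ.kind_b] at hs'; cases hs'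
    rcases hadj.2 with h | h | h | h | h | h
    · omega
    · omega
    · omega
    · obtain ⟨-, -, -, τ, h1, -⟩ := h
      rw [hpj] at h1
      exact Λ.mask_single j (by omega) hs' τ h1
    · rcases h with h | h <;> omega
    · rcases h with h | h <;> omega

lemma pos_eq_of_zero (h0 : pos (f 0) = 0) : ∀ j < k, pos (f j) = j := by
  intro j
  induction j using Nat.strong_induction_on with
  | _ j ih =>
    intro hj
    rcases j with _ | j
    · exact h0
    have ih' : ∀ i ≤ j, pos (f i) = i := fun i hi => ih i (by omega) (by omega)
    rcases hk : Λ.kind (j + 1) with _ | _ | _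
    · exact pos_succ_of_single hpos hlab hf hj ih' hk
    · exact pos_succ_of_first hpos hlab hf hj ih' hk
    · exact pos_succ_of_second hpos hlab hf hj ih' hk

omit hf in
/-- An induced path on `k` vertices can be listed from the vertex at position `0`. -/
lemma exists_path_from_zero (hf : IsInducedPath (Λ.graph pos lab X Y) k f) :
    ∃ g : ℕ → V, IsInducedPath (Λ.graph pos lab X Y) k g ∧ pos (g 0) = 0 := by
  have hk := Λ.one_lt
  obtain ⟨i, hi, hp⟩ := exists_of_single hpos hlab hf (by omega) Λ.kind_zero
  -- The neighbours of the vertex at position `0` all lie at position `1`, hence are pairwise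
  -- adjacent; so that vertex is an end of the path.
  have key : ∀ j < k, (Λ.graph pos lab X Y).Adj (f i) (f j) → pos (f j) = 1 := by
    intro j hj h
    have h0a : 0 ≠ Λ.a := by
      intro e
      have h1 := Λ.kind_a
      rw [← e, Λ.kind_zero] at h1; cases h1
    have h0b : 0 ≠ Λ.b := by
      intro e
      have h1 := Λ.kind_b
      rw [← e, Λ.kind_zero] at h1; cases h1
    have hne := h.1
    rcases h.2 with h | h | h | h | h | h
    · exact absurd (eq_of_single hpos hlab h (by rw [hp]; exact Λ.kind_zero)) hne
    · omega
    · omega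
    · obtain ⟨-, -, -, τ, h1, -⟩ := h
      rw [hp] at h1
      exact absurd h1 (Λ.mask_single 0 (by omega) Λ.kind_zero τ)
    · rcases h with h | h <;> omega
    · rcases h with h | h <;> omega
  rcases Nat.eq_zero_or_pos i with rfl | h0
  · exact ⟨f, hf, hp⟩
  rcases Nat.lt_or_ge (i + 1) k with h1 | h1
  · exfalso
    have a1 : (Λ.graph pos lab X Y).Adj (f i) (f (i + 1)) := by
      rw [hf.adj _ hi _ h1]; omega
    have a2 : (Λ.graph pos lab X Y).Adj (f i) (f (i - 1)) := by
      rw [hf.adj _ hi _ (by omega)]; omega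
    refine hf.triangle_free hi h1 (by omega) a1 a2 (adj_of_pos_eq ?_ ?_)
    · exact hf.ne h1 (by omega) (by omega)
    · rw [key _ h1 a1, key _ (by omega) a2]
  · refine ⟨_, hf.reverse, ?_⟩
    simp only [Nat.sub_zero]
    rwa [show k - 1 = i by omega]

omit hf in
/-- An induced path on `k` vertices spells out a pair of words that is allowed on both sides. -/
theorem exists_common_pair (hf : IsInducedPath (Λ.graph pos lab X Y) k f) :
    ∃ u v u' v' : V, pos u = Λ.a ∧ pos v = Λ.a + 2 ∧ pos u' = Λ.b ∧ pos v' = Λ.b + 2 ∧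
      X u v ∧ Y u' v' ∧ (∀ τ < d, lab u τ = lab u' τ) ∧ (∀ τ < d, lab v τ = lab v' τ) := by
  obtain ⟨g, hg, h0⟩ := exists_path_from_zero hpos hlab hf
  have hp := pos_eq_of_zero hpos hlab hg h0
  have hb := Λ.b_lt
  have ha := Λ.a_lt
  have key : ∀ (t : Bool), ∀ τ < d, lab (g (if t then Λ.a + 2 else Λ.a)) τ =
      lab (g (if t then Λ.b + 2 else Λ.b)) τ := by
    intro t τ hτ
    obtain ⟨c, c0, c1, hc⟩ := Λ.chain τ hτ t
    rw [← c0, ← c1]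
    have : ∀ i ≤ m + 1, lab (g (c 0)) τ = lab (g (c i)) τ := by
      intro i
      induction i with
      | zero => intro _; rfl
      | succ i ih =>
        intro hi
        rw [ih (by omega)]
        obtain ⟨h1, h2, h3, h4⟩ := hc i (by omega)
        obtain ⟨h1', h2', h3', h4'⟩ := hc (i + 1) hi
        by_contra hne
        have hcc : c i ≠ c (i + 1) := fun e => by rw [e] at h4; omega
        have hadj : (Λ.graph pos lab X Y).Adj (g (c i)) (g (c (i + 1))) := by
          refine ⟨hg.ne h1 h1' hcc, .inr (.inr (.inr (.inl ?_)))⟩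
          rw [Conflict, hp _ h1, hp _ h1']
          exact ⟨h3.trans h3'.symm, by omega, by omega, τ, h2, h2', hne⟩
        rw [hg.adj _ h1 _ h1'] at hadj
        rcases hadj with h | h
        · rw [← h] at h1' h2' h3'
          exact Λ.alternate _ h1' τ τ h2 h2' (h3.trans h3'.symm)
        · rw [← h] at h1 h2 h3
          exact Λ.alternate _ h1 τ τ h2' h2 (h3'.trans h3.symm)
    exact this (m + 1) le_rfl
  refine ⟨g Λ.a, g (Λ.a + 2), g Λ.b, g (Λ.b + 2), hp _ (by omega), hp _ ha, hp _ (by omega),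
    hp _ (by omega), ?_, ?_, fun τ hτ => by simpa using key false τ hτ,
    fun τ hτ => by simpa using key true τ hτ⟩
  · by_contra hX
    have hadj : (Λ.graph pos lab X Y).Adj (g Λ.a) (g (Λ.a + 2)) :=
      ⟨hg.ne (by omega) ha (by omega), .inr (.inr (.inr (.inr (.inl
        (.inl ⟨hp _ (by omega), hp _ ha, hX⟩)))))⟩
    rw [hg.adj _ (by omega) _ ha] at hadj
    omega
  · by_contra hY
    have hadj : (Λ.graph pos lab X Y).Adj (g Λ.b) (g (Λ.b + 2)) :=
      ⟨hg.ne (by omega) (by omega) (by omega), .inr (.inr (.inr (.inr (.inl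
        (.inr ⟨hp _ (by omega), hp _ (by omega), hY⟩)))))⟩
    rw [hg.adj _ (by omega) _ (by omega)] at hadj
    omega

end Forced

/-! ### Consistent choices give induced paths -/

section Basic

variable {k d m : ℕ} {Λ : Layout k d m} {V : Type} {pos : V → ℕ} {lab : V → ℕ → ℕ}
  {X Y : V → V → Prop}

/-- A choice of one vertex per position, without conflicts, is an induced path. -/
lemma isInducedPath_of_consistent {g : ℕ → V} (hp : ∀ p < k, pos (g p) = p)
    (hg : ∀ p < k, ∀ p' < k, Λ.typ p = Λ.typ p' → ∀ τ, Λ.mask p τ → Λ.mask p' τ →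
      lab (g p) τ = lab (g p') τ)
    (hX : X (g Λ.a) (g (Λ.a + 2))) (hY : Y (g Λ.b) (g (Λ.b + 2))) :
    IsInducedPath (Λ.graph pos lab X Y) k g where
  inj i hi j hj h := by rw [← hp i hi, ← hp j hj, h]
  adj i hi j hj := by
    have key : ∀ i < k, ∀ j < k, ¬ Λ.Forbidden pos X Y (g i) (g j) := by
      rintro i hi j hj (⟨h1, h2, h3⟩ | ⟨h1, h2, h3⟩)
      · rw [hp _ hi] at h1; rw [hp _ hj] at h2
        subst h1; subst h2; exact h3 hX
      · rw [hp _ hi] at h1; rw [hp _ hj] at h2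
        subst h1; subst h2; exact h3 hY
    constructor
    · rintro ⟨hne, h⟩
      have hij : i ≠ j := fun e => hne (by rw [e])
      rcases h with h | h | h | ⟨h1, -, -, τ, h4, h5, h6⟩ | h | h
      · rw [hp _ hi, hp _ hj] at h; exact absurd h hij
      · rw [hp _ hi, hp _ hj] at h; exact .inl h
      · rw [hp _ hi, hp _ hj] at h; exact .inr h
      · rw [hp _ hi] at h1 h4
        rw [hp _ hj] at h1 h5
        exact absurd (hg i hi j hj h1 τ h4 h5) h6
      · exact absurd h (key i hi j hj)
      · exact absurd h (key j hj i hi)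
    · rintro (h | h)
      · exact adj_of_pos_succ (by rw [hp _ hi, hp _ hj, h])
      · exact (adj_of_pos_succ (by rw [hp _ hi, hp _ hj, h])).symm

lemma graph_connected {g : ℕ → V} (hp : ∀ p < k, pos (g p) = p) (hpos : ∀ v, pos v < k) :
    (Λ.graph pos lab X Y).Connected := by
  have hk := Λ.one_lt
  have h1 : ∀ p < k, (Λ.graph pos lab X Y).Reachable (g 0) (g p) := by
    intro p
    induction p with
    | zero => intro _; rfl
    | succ p ih =>
      intro h
      exact (ih (by omega)).trans
        (adj_of_pos_succ (by rw [hp _ (by omega), hp _ h])).reachable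
  have h2 : ∀ v, (Λ.graph pos lab X Y).Reachable (g 0) v := by
    intro v
    refine (h1 _ (hpos v)).trans ?_
    by_cases e : g (pos v) = v
    · rw [e]
    · exact (adj_of_pos_eq e (hp _ (hpos v))).reachable
  have : Nonempty V := ⟨g 0⟩
  exact ⟨fun u v => (h2 u).symm.trans (h2 v)⟩

end Basic

end Layout

lemma not_pathFree_of_isInducedPath {V : Type} {G : SimpleGraph V} {k : ℕ} {f : ℕ → V}
    (hf : IsInducedPath G k f) : ¬ PathFree k G := by
  rw [PathFree, not_not]
  refine ⟨⟨⟨fun i => f i, fun i j h => Fin.ext (hf.inj _ i.2 _ j.2 h)⟩, ?_⟩⟩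
  intro i j
  rw [SimpleGraph.pathGraph_adj]
  exact hf.adj _ i.2 _ j.2

lemma exists_isInducedPath {V : Type} {G : SimpleGraph V} {k : ℕ} (hk : 0 < k)
    (h : ¬ PathFree k G) : ∃ f : ℕ → V, IsInducedPath G k f := by
  rw [PathFree, not_not] at h
  obtain ⟨φ⟩ := h
  have e : ∀ i < k, ∀ h : min i (k - 1) < k, (⟨min i (k - 1), h⟩ : Fin k).1 = i := by
    intro i hi h
    simp only
    omega
  -- Indices beyond `k - 1` are clamped; only those below `k` matter.
  refine ⟨fun i => φ ⟨min i (k - 1), by omega⟩, fun i hi j hj h => ?_, fun i hi j hj => ?_⟩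
  · have := congrArg Fin.val (φ.injective h)
    rwa [e i hi, e j hj] at this
  · rw [φ.map_adj_iff, SimpleGraph.pathGraph_adj, e i hi, e j hj]

/-! ### The concrete layout -/

/-- What a position stores. -/
structure Slot where
  kind : Kind
  typ : Bool
  lam : ℕ
  mask : ℕ → Prop

/-- The first position of the run number `t + 1`. -/
def runStart (m E t : ℕ) : ℕ := E + 7 + 2 * m + t * (2 * m + 1)

/-- The position `s` of the initial run. -/
def firstRunSlot (s : ℕ) : Slot :=
  ⟨if s % 2 = 0 then .second else .first, decide (s % 2 = 1), 1 + s / 2, (· = 0)⟩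

/-- The position `s` of the run number `t + 1`, including the hub at its end. -/
def runSlot (m t s : ℕ) : Slot :=
  if s = 2 * m then ⟨.single, false, if t % 2 = 0 then 1 else m, fun _ => False⟩
  else if t % 2 = 0 then
    ⟨if s % 2 = 0 then .first else .second, decide (s % 2 = 1), m - s / 2, (· = t + 1)⟩
  else
    ⟨if s % 2 = 0 then .first else .second, decide (s % 2 = 0), 1 + s / 2, (· = t + 1)⟩

/-- The sequence of positions: `E` hubs, the two words in full on the left with a hub between them,
a run to the right for their first digits, the two words in full on the right with a hub between
them, a hub, and a run followed by a hub for each further digit, in alternating directions. -/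
def slot (m E p : ℕ) : Slot :=
  if p < E then ⟨.single, false, 0, fun _ => False⟩
  else if p = E then ⟨.first, false, 0, fun _ => True⟩
  else if p = E + 1 then ⟨.second, false, 0, fun _ => False⟩
  else if p = E + 2 then ⟨.first, true, 0, fun _ => True⟩
  else if p < E + 3 + 2 * m then firstRunSlot (p - (E + 3))
  else if p = E + 3 + 2 * m then ⟨.second, false, m + 1, fun _ => True⟩
  else if p = E + 4 + 2 * m then ⟨.first, false, m + 1, fun _ => False⟩
  else if p = E + 5 + 2 * m then ⟨.second, true, m + 1, fun _ => True⟩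
  else if p = E + 6 + 2 * m then ⟨.single, false, m + 1, fun _ => False⟩
  else runSlot m ((p - (E + 7 + 2 * m)) / (2 * m + 1)) ((p - (E + 7 + 2 * m)) % (2 * m + 1))

section Slot

variable {m E p : ℕ}

lemma runStart_succ (t : ℕ) : runStart m E (t + 1) = runStart m E t + 2 * m + 1 := by
  simp only [runStart]; ring

lemma runStart_mono {t t' : ℕ} (h : t ≤ t') : runStart m E t ≤ runStart m E t' := by
  simp only [runStart]; gcongr

lemma le_runStart (t : ℕ) : E + 7 + 2 * m ≤ runStart m E t := by simp [runStart]

lemma slot_pendant (h : p < E) : slot m E p = ⟨.single, false, 0, fun _ => False⟩ := by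
  simp [slot, h]

lemma slot_left_one (h : p = E) : slot m E p = ⟨.first, false, 0, fun _ => True⟩ := by
  simp [slot, h]

lemma slot_left_hub (h : p = E + 1) : slot m E p = ⟨.second, false, 0, fun _ => False⟩ := by
  simp [slot, h]

lemma slot_left_two (h : p = E + 2) : slot m E p = ⟨.first, true, 0, fun _ => True⟩ := by
  simp [slot, h]

lemma slot_firstRun {s : ℕ} (hs : s < 2 * m) (h : p = E + 3 + s) :
    slot m E p = firstRunSlot s := by
  subst h
  rw [slot, if_neg (by omega), if_neg (by omega), if_neg (by omega), if_neg (by omega),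
    if_pos (by omega)]
  congr 1
  omega

lemma slot_right_one (h : p = E + 3 + 2 * m) :
    slot m E p = ⟨.second, false, m + 1, fun _ => True⟩ := by
  rw [slot, if_neg (by omega), if_neg (by omega), if_neg (by omega), if_neg (by omega),
    if_neg (by omega), if_pos h]

lemma slot_right_hub (h : p = E + 4 + 2 * m) :
    slot m E p = ⟨.first, false, m + 1, fun _ => False⟩ := by
  rw [slot, if_neg (by omega), if_neg (by omega), if_neg (by omega), if_neg (by omega),
    if_neg (by omega), if_neg (by omega), if_pos h]

lemma slot_right_two (h : p = E + 5 + 2 * m) :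
    slot m E p = ⟨.second, true, m + 1, fun _ => True⟩ := by
  rw [slot, if_neg (by omega), if_neg (by omega), if_neg (by omega), if_neg (by omega),
    if_neg (by omega), if_neg (by omega), if_neg (by omega), if_pos h]

lemma slot_turn (h : p = E + 6 + 2 * m) :
    slot m E p = ⟨.single, false, m + 1, fun _ => False⟩ := by
  rw [slot, if_neg (by omega), if_neg (by omega), if_neg (by omega), if_neg (by omega),
    if_neg (by omega), if_neg (by omega), if_neg (by omega), if_neg (by omega), if_pos h]

lemma slot_run {t s : ℕ} (hs : s ≤ 2 * m) (h : p = runStart m E t + s) :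
    slot m E p = runSlot m t s := by
  have hp : p - (E + 7 + 2 * m) = s + (2 * m + 1) * t := by
    have := mul_comm t (2 * m + 1)
    rw [h, runStart]; omega
  have := le_runStart (m := m) (E := E) t
  rw [slot, if_neg (by omega), if_neg (by omega), if_neg (by omega), if_neg (by omega),
    if_neg (by omega), if_neg (by omega), if_neg (by omega), if_neg (by omega), if_neg (by omega),
    hp, Nat.add_mul_div_left _ _ (by omega), Nat.add_mul_mod_self_left, Nat.div_eq_of_lt (by omega),
    Nat.mod_eq_of_lt (by omega), Nat.zero_add]

lemma slot_runStart_succ (hm : 0 < m) {t : ℕ} (h : p = runStart m E t + 2 * m + 1) :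
    slot m E p = runSlot m (t + 1) 0 :=
  slot_run (by omega) (by rw [runStart_succ]; omega)

/-- The possible places of a position. -/
inductive Place (m E p : ℕ) : Prop
  | pendant (h : p < E)
  | leftOne (h : p = E)
  | leftHub (h : p = E + 1)
  | leftTwo (h : p = E + 2)
  | firstRun (s : ℕ) (hs : s < 2 * m) (h : p = E + 3 + s)
  | rightOne (h : p = E + 3 + 2 * m)
  | rightHub (h : p = E + 4 + 2 * m)
  | rightTwo (h : p = E + 5 + 2 * m)
  | turn (h : p = E + 6 + 2 * m)
  | run (t s : ℕ) (hs : s < 2 * m) (h : p = runStart m E t + s)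
  | hub (t : ℕ) (h : p = runStart m E t + 2 * m)

lemma place (m E p : ℕ) : Place m E p := by
  by_cases h1 : p < E + 3
  · by_cases h2 : p < E
    · exact .pendant h2
    · obtain h | h | h : p = E ∨ p = E + 1 ∨ p = E + 2 := by omega
      exacts [.leftOne h, .leftHub h, .leftTwo h]
  by_cases h2 : p < E + 3 + 2 * m
  · exact .firstRun (p - (E + 3)) (by omega) (by omega)
  by_cases h3 : p < E + 7 + 2 * m
  · obtain h | h | h | h : p = E + 3 + 2 * m ∨ p = E + 4 + 2 * m ∨ p = E + 5 + 2 * m ∨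
      p = E + 6 + 2 * m := by omega
    exacts [.rightOne h, .rightHub h, .rightTwo h, .turn h]
  have hp : p = runStart m E ((p - (E + 7 + 2 * m)) / (2 * m + 1)) +
      (p - (E + 7 + 2 * m)) % (2 * m + 1) := by
    have := Nat.div_add_mod (p - (E + 7 + 2 * m)) (2 * m + 1)
    rw [mul_comm] at this
    rw [runStart]; omega
  have hlt := Nat.mod_lt (p - (E + 7 + 2 * m)) (show 2 * m + 1 > 0 by omega)
  by_cases h4 : (p - (E + 7 + 2 * m)) % (2 * m + 1) = 2 * m
  · exact .hub _ (by rw [h4] at hp; exact hp)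
  · exact .run _ _ (by omega) hp

lemma runSlot_hub (t : ℕ) :
    runSlot m t (2 * m) = ⟨.single, false, if t % 2 = 0 then 1 else m, fun _ => False⟩ := by
  simp [runSlot]

lemma slot_hub {t : ℕ} (h : p = runStart m E t + 2 * m) :
    slot m E p = ⟨.single, false, if t % 2 = 0 then 1 else m, fun _ => False⟩ := by
  rw [slot_run le_rfl h, runSlot_hub]

lemma runSlot_of_lt {t s : ℕ} (hs : s < 2 * m) :
    runSlot m t s = ⟨if s % 2 = 0 then .first else .second,
      if t % 2 = 0 then decide (s % 2 = 1) else decide (s % 2 = 0),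
      if t % 2 = 0 then m - s / 2 else 1 + s / 2, (· = t + 1)⟩ := by
  rw [runSlot, if_neg (by omega)]
  split_ifs <;> rfl


lemma runSlot_zero (hm : 0 < m) (t : ℕ) :
    runSlot m t 0 = ⟨.first, decide (t % 2 = 1), if t % 2 = 0 then m else 1, (· = t + 1)⟩ := by
  rw [runSlot_of_lt (by omega)]
  rcases Nat.mod_two_eq_zero_or_one t with h | h <;> simp [h]

lemma slot_next (hm : 0 < m) {t : ℕ} (h : p = runStart m E t + 2 * m + 1) :
    slot m E p =
      ⟨.first, decide (t % 2 = 0), if t % 2 = 0 then 1 else m, (· = t + 2)⟩ := by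
  rw [slot_runStart_succ hm h, runSlot_zero hm]
  rcases Nat.mod_two_eq_zero_or_one t with h | h <;>
    simp [Nat.add_mod, h]

lemma slot_run_zero (hm : 0 < m) (h : p = E + 7 + 2 * m) :
    slot m E p = ⟨.first, false, m, (· = 1)⟩ := by
  rw [slot_run (t := 0) (s := 0) (by omega) (by simp [runStart]; omega), runSlot_zero hm]
  simp

/-- How the kinds, types and coordinates of two consecutive positions are related. -/
lemma slot_step (hm : 0 < m) (p : ℕ) :
    ((slot m E p).kind = .first → (slot m E (p + 1)).kind = .second) ∧
    ((slot m E (p + 1)).kind = .second → (slot m E p).kind = .first) ∧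
    (∀ τ τ', (slot m E p).mask τ → (slot m E (p + 1)).mask τ' →
      (slot m E p).typ ≠ (slot m E (p + 1)).typ) ∧
    (slot m E p).lam ≤ (slot m E (p + 1)).lam + 1 ∧
    (slot m E (p + 1)).lam ≤ (slot m E p).lam + 1 := by
  rcases place m E p with h | h | h | h | ⟨s, hs, h⟩ | h | h | h | h | ⟨t, s, hs, h⟩ | ⟨t, h⟩
  · rcases Nat.lt_or_ge (p + 1) E with h' | h'
    · rw [slot_pendant h, slot_pendant h']; simp
    · rw [slot_pendant h, slot_left_one (by omega)]; simp
  · rw [slot_left_one h, slot_left_hub (by omega)]; simp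
  · rw [slot_left_hub h, slot_left_two (by omega)]; simp
  · rw [slot_left_two h, slot_firstRun (s := 0) (by omega) (by omega)]; simp [firstRunSlot]
  · rcases Nat.lt_or_ge (s + 1) (2 * m) with h' | h'
    · rw [slot_firstRun hs h, slot_firstRun (s := s + 1) h' (by omega)]
      rcases Nat.mod_two_eq_zero_or_one s with e | e <;> simp [firstRunSlot, e, Nat.add_mod] <;>
        omega
    · have e : s % 2 = 1 := by omega
      rw [slot_firstRun hs h, slot_right_one (by omega)]
      simp [firstRunSlot, e]; omega
  · rw [slot_right_one h, slot_right_hub (by omega)]; simp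
  · rw [slot_right_hub h, slot_right_two (by omega)]; simp
  · rw [slot_right_two h, slot_turn (by omega)]; simp
  · rw [slot_turn h, slot_run_zero hm (by omega)]; simp; omega
  · rw [slot_run hs.le h, runSlot_of_lt hs]
    rcases Nat.lt_or_ge (s + 1) (2 * m) with h' | h'
    · rw [slot_run (s := s + 1) (t := t) h'.le (by omega), runSlot_of_lt h']
      rcases Nat.mod_two_eq_zero_or_one s with e | e <;>
        rcases Nat.mod_two_eq_zero_or_one t with e' | e' <;> simp [e, e', Nat.add_mod] <;>
        omega
    · have e : s % 2 = 1 := by omega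
      rw [slot_hub (t := t) (by omega)]
      rcases Nat.mod_two_eq_zero_or_one t with e' | e' <;> simp [e, e'] <;> omega
  · rw [slot_hub h, slot_next hm (t := t) (by omega)]
    simp


lemma slot_mask_of_single (h : (slot m E p).kind = .single) (τ : ℕ) : ¬ (slot m E p).mask τ := by
  rcases place m E p with h | h' | h' | h' | ⟨s, hs, h'⟩ | h' | h' | h' | h' | ⟨t, s, hs, h'⟩ |
    ⟨t, h'⟩
  · rw [slot_pendant h]; simp
  · rw [slot_left_one h'] at h; cases h
  · rw [slot_left_hub h'] at h; cases h
  · rw [slot_left_two h'] at h; cases h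
  · rw [slot_firstRun hs h', firstRunSlot] at h; simp only at h; split_ifs at h
  · rw [slot_right_one h'] at h; cases h
  · rw [slot_right_hub h'] at h; cases h
  · rw [slot_right_two h'] at h; cases h
  · rw [slot_turn h']; simp
  · rw [slot_run hs.le h', runSlot_of_lt hs] at h; simp only at h; split_ifs at h
  · rw [slot_hub h']; simp

/-- Two positions store a common digit, of the same word, on nearby layers. -/
def Comparable (S T : Slot) : Prop :=
  S.typ = T.typ ∧ S.lam ≤ T.lam + 1 ∧ T.lam ≤ S.lam + 1 ∧ ∃ τ, S.mask τ ∧ T.mask τ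

/-- Inside a run, the only later comparable position is `j + 2`. The other source is the first word
on the right, which is compared with every later run. Alternating directions and swapping the types
in every other run put its counterpart on layer `m` at an end of the run, next to a hub. -/
lemma slot_guarded {j : ℕ} (hjp : j + 2 < p) (hj : (slot m E j).kind = .second)
    (hj1 : (slot m E (j + 1)).kind = .first) (h : Comparable (slot m E j) (slot m E p)) :
    (slot m E (p - 1)).kind = .single ∨ (slot m E (p + 1)).kind = .single := by
  obtain ⟨c1, c2, c3, τ, c4, c5⟩ := h
  rcases place m E j with h | h | h | h | ⟨s, hs, h⟩ | h | h | h | h | ⟨t, s, hs, h⟩ | ⟨t, h⟩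
  · rw [slot_pendant h] at hj; cases hj
  · rw [slot_left_one h] at hj; cases hj
  · rw [slot_left_hub h] at c4; exact c4.elim
  · rw [slot_left_two h] at hj; cases hj
  · rw [slot_firstRun hs h, firstRunSlot] at hj c1 c2 c3 c4
    have e : s % 2 = 0 := by
      by_contra e; simp [e] at hj
    simp only [e, zero_ne_one, decide_false] at c1 c2 c3 c4
    subst c4
    exfalso
    rcases place m E p with h' | h' | h' | h' | ⟨s', hs', h'⟩ | h' | h' | h' | h' | ⟨t', s', hs', h'⟩ |
      ⟨t', h'⟩
    · omega
    · omega
    · omega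
    · omega
    · rw [slot_firstRun hs' h', firstRunSlot] at c1 c2 c3
      simp at c1 c2 c3; omega
    · rw [slot_right_one h'] at c2 c3
      simp at c2 c3; omega
    · rw [slot_right_hub h'] at c5; exact c5
    · rw [slot_right_two h'] at c1; cases c1
    · rw [slot_turn h'] at c5; exact c5
    · rw [slot_run hs'.le h', runSlot_of_lt hs'] at c5
      simp at c5
    · rw [slot_hub h'] at c5; exact c5
  · rw [slot_right_one h] at c1 c2 c3
    rcases place m E p with h' | h' | h' | h' | ⟨s', hs', h'⟩ | h' | h' | h' | h' | ⟨t', s', hs', h'⟩ |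
      ⟨t', h'⟩
    · omega
    · omega
    · omega
    · omega
    · omega
    · omega
    · omega
    · omega
    · rw [slot_turn h'] at c5; exact c5.elim
    · rw [slot_run hs'.le h', runSlot_of_lt hs'] at c1 c2 c3
      rcases Nat.mod_two_eq_zero_or_one t' with e' | e'
      · simp [e'] at c1 c2 c3
        left
        have e0 : s' = 0 := by omega
        rcases t' with _ | t'
        · rw [slot_turn (by simp [runStart] at h'; omega)]
        · rw [slot_hub (t := t') (by rw [runStart_succ] at h'; omega)]
      · simp [e'] at c1 c2 c3
        right
        rw [slot_hub (t := t') (by omega)]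
    · rw [slot_hub h'] at c5; exact c5.elim
  · rw [slot_right_hub h] at hj; cases hj
  · rw [slot_turn (by omega)] at hj1; cases hj1
  · rw [slot_turn h] at hj; cases hj
  · exfalso
    rw [slot_run hs.le h, runSlot_of_lt hs] at hj c1 c2 c3 c4
    have e : s % 2 = 1 := by
      by_contra e
      have : s % 2 = 0 := by omega
      simp [this] at hj
    simp [e] at c1 c2 c3 c4
    subst c4
    have hle := le_runStart (m := m) (E := E) t
    rcases place m E p with h' | h' | h' | h' | ⟨s', hs', h'⟩ | h' | h' | h' | h' | ⟨t', s', hs', h'⟩ |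
      ⟨t', h'⟩
    · omega
    · omega
    · omega
    · omega
    · omega
    · omega
    · omega
    · omega
    · omega
    · rw [slot_run hs'.le h', runSlot_of_lt hs'] at c1 c2 c3 c5
      simp at c5
      subst c5
      rcases Nat.mod_two_eq_zero_or_one t with e' | e' <;> simp [e'] at c1 c2 c3 <;> omega
    · rw [slot_hub h'] at c5; exact c5
  · rw [slot_hub h] at hj; cases hj

/-- Inside a run the same digit recurs at `j + 2` and `j + 4`. At the end of the initial run, `j +
5` is the hub after the right side; in the later runs, the closing hub contradicts the assumption on
`j + 1` or `j + 3`. -/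
lemma slot_stable {j : ℕ} (hj : (slot m E j).kind = .second)
    (hj1 : (slot m E (j + 1)).kind = .first) (h : Comparable (slot m E j) (slot m E (j + 2)))
    (hj3 : (slot m E (j + 3)).kind = .first) :
    (slot m E (j + 5)).kind = .single ∨ (j + 2 ≠ E ∧ ∃ τ, (∀ τ', (slot m E (j + 2)).mask τ' → τ' = τ) ∧
      (slot m E (j + 4)).mask τ ∧ (slot m E (j + 2)).typ = (slot m E (j + 4)).typ ∧
      (slot m E (j + 2)).lam ≤ (slot m E (j + 4)).lam + 1 ∧
      (slot m E (j + 4)).lam ≤ (slot m E (j + 2)).lam + 1) := by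
  obtain ⟨c1, c2, c3, τ, c4, c5⟩ := h
  rcases place m E j with h | h | h | h | ⟨s, hs, h⟩ | h | h | h | h | ⟨t, s, hs, h⟩ | ⟨t, h⟩
  · rw [slot_pendant h] at hj; cases hj
  · rw [slot_left_one h] at hj; cases hj
  · rw [slot_left_hub h] at c4; exact c4.elim
  · rw [slot_left_two h] at hj; cases hj
  · rw [slot_firstRun hs h, firstRunSlot] at hj
    have e : s % 2 = 0 := by
      by_contra e; simp [e] at hj
    rcases Nat.lt_or_ge (s + 2) (2 * m) with h2 | h2
    · right
      refine ⟨by omega, 0, ?_⟩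
      rw [slot_firstRun (s := s + 2) (p := j + 2) h2 (by omega)]
      rcases Nat.lt_or_ge (s + 4) (2 * m) with h4 | h4
      · rw [slot_firstRun (s := s + 4) (p := j + 4) h4 (by omega)]
        simp [firstRunSlot]
        omega
      · rw [slot_right_one (p := j + 4) (by omega)]
        simp [firstRunSlot, e]
        omega
    · left
      rw [slot_turn (by omega)]
  · rw [slot_turn (p := j + 3) (by omega)] at hj3; cases hj3
  · rw [slot_right_hub h] at hj; cases hj
  · rw [slot_turn (by omega)] at hj1; cases hj1
  · rw [slot_turn h] at hj; cases hj
  · right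
    have hle := le_runStart (m := m) (E := E) t
    rw [slot_run hs.le h, runSlot_of_lt hs] at hj
    have e : s % 2 = 1 := by
      by_contra e
      have : s % 2 = 0 := by omega
      simp [this] at hj
    have h1 : s + 1 ≠ 2 * m := by
      intro h1
      rw [slot_hub (t := t) (by omega)] at hj1; cases hj1
    have h3 : s + 3 ≠ 2 * m := by
      intro h1
      rw [slot_hub (t := t) (by omega)] at hj3; cases hj3
    refine ⟨by omega, t + 1, ?_⟩
    rw [slot_run (p := j + 2) (s := s + 2) (t := t) (by omega) (by omega),
      slot_run (p := j + 4) (s := s + 4) (t := t) (by omega) (by omega),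
      runSlot_of_lt (by omega), runSlot_of_lt (by omega)]
    rcases Nat.mod_two_eq_zero_or_one t with e' | e' <;> simp [e', Nat.add_mod, e] <;> omega
  · rw [slot_hub h] at hj; cases hj


lemma slot_last (D : ℕ) : (slot m E (runStart m E D - 1)).kind = .single := by
  rcases D with _ | D
  · rw [slot_turn (by simp [runStart])]
  · rw [slot_hub (t := D) (by rw [runStart_succ]; omega)]

lemma succ_lt_of_kind_ne {D : ℕ} (hp : p < runStart m E D) (h : (slot m E p).kind ≠ .single) :
    p + 1 < runStart m E D := by
  by_contra hlt
  apply h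
  rw [show p = runStart m E D - 1 by omega]
  exact slot_last D

lemma exists_slot_chain {D τ : ℕ} (hτ : τ < D + 1) (t : Bool) :
    ∃ c : ℕ → ℕ, ∀ i, 1 ≤ i → i ≤ m → c i < runStart m E D ∧ (slot m E (c i)).mask τ ∧
      (slot m E (c i)).typ = t ∧ (slot m E (c i)).lam = i := by
  have hle := le_runStart (m := m) (E := E) D
  rcases τ with _ | τ
  · refine ⟨fun i => E + 3 + (2 * (i - 1) + t.toNat), fun i h1 h2 => ?_⟩
    have ht : t.toNat ≤ 1 := by cases t <;> simp
    refine ⟨by simp only; omega, ?_⟩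
    rw [slot_firstRun (s := 2 * (i - 1) + t.toNat) (by omega) rfl, firstRunSlot]
    refine ⟨rfl, ?_, ?_⟩
    · cases t <;> simp
    · simp only; omega
  · have hD : runStart m E τ + 2 * m + 1 ≤ runStart m E D := by
      rw [← runStart_succ]; exact runStart_mono (by omega)
    rcases Nat.mod_two_eq_zero_or_one τ with e | e
    · refine ⟨fun i => runStart m E τ + (2 * (m - i) + t.toNat), fun i h1 h2 => ?_⟩
      have ht : t.toNat ≤ 1 := by cases t <;> simp
      refine ⟨by simp only; omega, ?_⟩
      rw [slot_run (s := 2 * (m - i) + t.toNat) (by omega) rfl, runSlot_of_lt (by omega)]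
      refine ⟨rfl, ?_, ?_⟩
      · cases t <;> simp [e]
      · simp only [e, if_true]; omega
    · refine ⟨fun i => runStart m E τ + (2 * (i - 1) + (!t).toNat), fun i h1 h2 => ?_⟩
      have ht : (!t).toNat ≤ 1 := by cases t <;> simp
      refine ⟨by simp only; omega, ?_⟩
      rw [slot_run (s := 2 * (i - 1) + (!t).toNat) (by omega) rfl, runSlot_of_lt (by omega)]
      refine ⟨rfl, ?_, ?_⟩
      · cases t <;> simp [e]
      · simp only [e, one_ne_zero, if_false]; omega

end Slot

/-- The layout for words of `D + 1` digits. -/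
def pathLayout (m E D : ℕ) (hm : 0 < m) (hE : 0 < E) : Layout (runStart m E D) (D + 1) m where
  kind p := (slot m E p).kind
  typ p := (slot m E p).typ
  lam p := (slot m E p).lam
  mask p := (slot m E p).mask
  a := E
  b := E + 3 + 2 * m
  kind_zero := by rw [slot_pendant hE]
  one_lt := by have := le_runStart (m := m) (E := E) D; omega
  first_succ p _ := (slot_step hm p).1
  second_pred p _ := (slot_step hm p).2.1
  second_lt p hp h := succ_lt_of_kind_ne hp (by rw [h]; simp)
  first_lt p hp h := succ_lt_of_kind_ne hp (by rw [h]; simp)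
  mask_single _ _ := slot_mask_of_single
  kind_a := by rw [slot_left_one rfl]
  kind_b := by rw [slot_right_one rfl]
  kind_b_add := by rw [slot_turn (by omega)]
  b_lt := by have := le_runStart (m := m) (E := E) D; omega
  a_lt := by have := le_runStart (m := m) (E := E) D; omega
  guarded j p hjp hp hj hj1 c1 c2 c3 c4 := by
    rcases slot_guarded hjp hj hj1 ⟨c1, c2, c3, c4⟩ with h | h
    · exact .inl ⟨by omega, h⟩
    · refine .inr ⟨succ_lt_of_kind_ne hp fun h' => ?_, h⟩
      obtain ⟨τ, -, h5⟩ := c4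
      exact slot_mask_of_single h' τ h5
  stable j hj4 hj hj1 c1 c2 c3 c4 hj3 := by
    rcases slot_stable hj hj1 ⟨c1, c2, c3, c4⟩ hj3 with h | h
    · refine .inl ⟨succ_lt_of_kind_ne hj4 ?_, h⟩
      rw [(slot_step hm (j + 3)).1 hj3]; simp
    · exact .inr h
  alternate p _ := (slot_step hm p).2.2.1
  chain τ hτ t := by
    have hle := le_runStart (m := m) (E := E) D
    obtain ⟨c, hc⟩ := exists_slot_chain (m := m) (E := E) hτ t
    refine ⟨fun i => if i = 0 then (if t then E + 2 else E) else
      if i = m + 1 then (if t then E + 3 + 2 * m + 2 else E + 3 + 2 * m) else c i, by simp, by simp,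
      fun i hi => ?_⟩
    by_cases h0 : i = 0
    · subst h0
      cases t
      · simp only [if_true, Bool.false_eq_true, if_false]
        rw [slot_left_one rfl]
        exact ⟨by omega, trivial, rfl, rfl⟩
      · simp only [if_true]
        rw [slot_left_two rfl]
        exact ⟨by omega, trivial, rfl, rfl⟩
    by_cases h1 : i = m + 1
    · subst h1
      cases t
      · simp only [if_true, Bool.false_eq_true, if_false, h0]
        rw [slot_right_one rfl]
        exact ⟨by omega, trivial, rfl, rfl⟩
      · simp only [if_true, h0, if_false]
        rw [slot_right_two (by omega)]
        exact ⟨by omega, trivial, rfl, rfl⟩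
    simp only [h0, h1, if_false]
    exact hc i (by omega) (by omega)

/-! ### The fooling argument across a separator -/

section Cut

variable {V : Type}

/-- Walks that stay where two graphs agree are walks of both. -/
lemma edist_le_of_agree {G G' : SimpleGraph V} (R : ℕ → V → Prop)
    (hstep : ∀ n u w, R (n + 1) u → G.Adj u w → R n w)
    (hmono : ∀ n u, R (n + 1) u → R n u)
    (hagree : ∀ u w, R 0 u → R 0 w → G.Adj u w → G'.Adj u w) {u v : V} (p : G.Walk u v) :
    ∀ n, p.length ≤ n → R n u → R 0 v ∧ G'.edist u v ≤ (n : ℕ∞) := by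
  have hzero : ∀ n u, R n u → R 0 u := by
    intro n u
    induction n with
    | zero => exact id
    | succ n ih => exact fun h => ih (hmono n u h)
  induction p with
  | nil => intro n _ h; exact ⟨hzero n _ h, by simp⟩
  | @cons u w v h p ih =>
    intro n hn hR
    rcases n with _ | n
    · simp at hn
    obtain ⟨h1, h2⟩ := ih n (by simpa using hn) (hstep n u w hR h)
    refine ⟨h1, ?_⟩
    have h3 : G'.Adj u w := hagree u w (hzero _ _ hR) (hzero _ _ (hstep n u w hR h)) h
    calc G'.edist u v ≤ G'.edist u w + G'.edist w v := SimpleGraph.edist_triangle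
      _ ≤ 1 + n := add_le_add (le_of_eq (SimpleGraph.edist_eq_one_iff_adj.2 h3)) h2
      _ = ((n + 1 : ℕ) : ℕ∞) := by push_cast; ring

/-- `R n u` is to be read as: from `u`, `n` more steps stay in the region of agreement. -/
lemma hopBall_subset_of_agree {G G' : SimpleGraph V} (R : ℕ → V → Prop)
    (hstep : ∀ n u w, R (n + 1) u → G.Adj u w → R n w)
    (hmono : ∀ n u, R (n + 1) u → R n u)
    (hagree : ∀ u w, R 0 u → R 0 w → G.Adj u w → G'.Adj u w) {ℓ : ℕ} {u v : V} (hu : R ℓ u)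
    (hv : v ∈ hopBall G ℓ u) : R 0 v ∧ v ∈ hopBall G' ℓ u := by
  have hv' : G.edist u v ≤ (ℓ : ℕ∞) := hv
  obtain ⟨p, hp⟩ := SimpleGraph.exists_walk_of_edist_ne_top
    (ne_top_of_le_ne_top (ENat.natCast_ne_top ℓ) hv')
  rw [← hp] at hv'
  exact edist_le_of_agree R hstep hmono hagree p ℓ (by exact_mod_cast hv') hu

/-- Nodes whose ball lies where two labelled graphs agree have the same view in both. -/
lemma localView_eq_of_agree {s : ℕ} {G G' : SimpleGraph V} (ident : V → ℕ)
    {c c' : V → Certificate s} (R : ℕ → V → Prop)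
    (hstep : ∀ n u w, R (n + 1) u → G.Adj u w → R n w)
    (hstep' : ∀ n u w, R (n + 1) u → G'.Adj u w → R n w)
    (hmono : ∀ n u, R (n + 1) u → R n u)
    (hagree : ∀ u w, R 0 u → R 0 w → (G.Adj u w ↔ G'.Adj u w))
    (hc : ∀ v, R 0 v → c v = c' v) {ℓ : ℕ} {u : V} (hu : R ℓ u) :
    localView G ident c ℓ u = localView G' ident c' ℓ u := by
  have h1 : ∀ v, v ∈ hopBall G ℓ u → R 0 v ∧ v ∈ hopBall G' ℓ u := fun v hv =>
    hopBall_subset_of_agree R hstep hmono (fun u w hu hw => (hagree u w hu hw).1) hu hv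
  have h2 : ∀ v, v ∈ hopBall G' ℓ u → R 0 v ∧ v ∈ hopBall G ℓ u := fun v hv =>
    hopBall_subset_of_agree R hstep' hmono (fun u w hu hw => (hagree u w hu hw).2) hu hv
  simp only [localView, LocalView.mk.injEq, true_and]
  constructor
  · ext p
    constructor
    · rintro ⟨v, hv, rfl⟩
      exact ⟨v, (h1 v hv).2, by rw [hc v (h1 v hv).1]⟩
    · rintro ⟨v, hv, rfl⟩
      exact ⟨v, (h2 v hv).2, by rw [hc v (h2 v hv).1]⟩
  · ext p
    constructor
    · rintro ⟨v, hv, w, hw, h, rfl⟩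
      exact ⟨v, (h1 v hv).2, w, (h1 w hw).2, (hagree v w (h1 v hv).1 (h1 w hw).1).1 h, rfl⟩
    · rintro ⟨v, hv, w, hw, h, rfl⟩
      exact ⟨v, (h2 v hv).2, w, (h2 w hw).2, (hagree v w (h2 v hv).1 (h2 w hw).1).2 h, rfl⟩

/-- Certificates restricted to a wide separator must distinguish all inputs of a family of graphs
that tests the disjointness of the input `x` on the low side and the input `y` on the high side. -/
theorem card_le_of_hasPLS [Fintype V] {ι : Type} [Fintype ι] {P : ∀ V : Type, SimpleGraph V → Prop}
    (G : (ι → Bool) → (ι → Bool) → SimpleGraph V) (φ : V → ℕ) {lo hi ℓ M s : ℕ}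
    (hlohi : lo + 4 * ℓ < hi)
    (hlip : ∀ x y u v, (G x y).Adj u v → φ u ≤ φ v + 2)
    (hx : ∀ x x' y u v, lo < φ u → lo < φ v → ((G x y).Adj u v ↔ (G x' y).Adj u v))
    (hy : ∀ x y y' u v, φ u < hi → φ v < hi → ((G x y).Adj u v ↔ (G x y').Adj u v))
    (hconn : ∀ x y, (G x y).Connected)
    (hpos : ∀ x, P V (G x fun i => !x i))
    (hneg : ∀ x y i, x i = true → y i = true → ¬ P V (G x y))
    (hM : Fintype.card V ≤ M) (h : HasPLS P ℓ (Fintype.card V) M s) :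
    Fintype.card ι ≤ s * Fintype.card {v // lo < φ v ∧ φ v < hi} := by
  classical
  obtain ⟨A, hA⟩ := h
  set ident : V → ℕ := fun v => (Fintype.equivFin V v : ℕ) with hident
  have hinj : Function.Injective ident := fun u v h =>
    (Fintype.equivFin V).injective (Fin.ext h)
  have hlt : ∀ v, ident v < M := fun v => lt_of_lt_of_le (Fin.is_lt _) hM
  have hA' := fun x y => hA V (G x y) ident rfl (hconn x y) hinj hlt
  choose c hc using fun x => (hA' x fun i => !x i).1 (hpos x)
  have key : ∀ x x' : ι → Bool, (∀ v, lo < φ v → φ v < hi → c x v = c x' v) →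
      ∀ i, x i = true → x' i = true := by
    intro x x' hxx i hxi
    by_contra hne
    -- The graph of `x` and the complement of `x'` must be rejected, even with the certificates of
    -- `x` and `x'` glued along the separator.
    obtain ⟨u, hu⟩ := (hA' x fun i => !x' i).2
      (hneg _ _ i hxi (by simpa using hne)) (fun v => if φ v < hi then c x v else c x' v)
    -- An edge changes `φ` by at most `2`, so a ball of radius `ℓ` spans `2 * ℓ` each way. As `hi -
    -- lo` exceeds `4 * ℓ`, the ball of `u` misses the high side or the low side, and its view
    -- occurs in an accepted instance.
    rcases Nat.lt_or_ge (φ u + 2 * ℓ) hi with hlow | hhigh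
    · have := localView_eq_of_agree (G := G x fun i => !x' i) (G' := G x fun i => !x i) ident
        (c := fun v => if φ v < hi then c x v else c x' v) (c' := c x)
        (fun n v => φ v + 2 * n < hi)
        (fun n u w h1 h2 => by have := hlip _ _ _ _ h2.symm; omega)
        (fun n u w h1 h2 => by have := hlip _ _ _ _ h2.symm; omega)
        (fun n u h => by omega)
        (fun u w h1 h2 => hy _ _ _ _ _ (by omega) (by omega))
        (fun v hv => if_pos (by omega)) hlow
      rw [this, hc x u] at hu
      cases hu
    · have := localView_eq_of_agree (G := G x fun i => !x' i) (G' := G x' fun i => !x' i) ident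
        (c := fun v => if φ v < hi then c x v else c x' v) (c' := c x')
        (fun n v => lo + 2 * n < φ v)
        (fun n u w h1 h2 => by have := hlip _ _ _ _ h2; omega)
        (fun n u w h1 h2 => by have := hlip _ _ _ _ h2; omega)
        (fun n u h => by omega)
        (fun u w h1 h2 => hx _ _ _ _ _ (by omega) (by omega))
        (fun v hv => by
          by_cases h : φ v < hi
          · simp only [h, if_true]; exact hxx v (by omega) h
          · simp only [h, if_false]) (show lo + 2 * ℓ < φ u by omega)
      rw [this, hc x' u] at hu
      cases hu
  have hcinj : Function.Injective
      (fun x => fun v : {v // lo < φ v ∧ φ v < hi} => c x v.1) := by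
    intro x x' h
    have h1 : ∀ v, lo < φ v → φ v < hi → c x v = c x' v := fun v h1 h2 =>
      congrFun h ⟨v, h1, h2⟩
    funext i
    rw [Bool.eq_iff_iff]
    exact ⟨key x x' h1 i, key x' x (fun v a b => (h1 v a b).symm) i⟩
  have hcard := Fintype.card_le_of_injective _ hcinj
  simp only [Fintype.card_fun, Fintype.card_bool, Fintype.card_fin, ← pow_mul] at hcard
  exact (Nat.pow_le_pow_iff_right (by norm_num)).1 hcard

end Cut

/-! ### The graph of words -/

namespace Layout

variable {k d m : ℕ} (Λ : Layout k d m) (q r : ℕ)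

/-- A position together with the digits that it stores (the other digits are set to `0`). -/
def Core : Type :=
  {v : Fin k × (Fin d → Fin q) // ∀ τ : Fin d, ¬ Λ.mask v.1 τ → (v.2 τ : ℕ) = 0}

noncomputable instance : Fintype (Λ.Core q) := by
  classical
  exact inferInstanceAs (Fintype {v : Fin k × (Fin d → Fin q) //
    ∀ τ : Fin d, ¬ Λ.mask v.1 τ → (v.2 τ : ℕ) = 0})

/-- The vertices: those of the layout, and `r` more at the position `a`, to adjust the order of the
graph. -/
abbrev Vert : Type := Λ.Core q ⊕ Fin r

variable {Λ q r}

/-- The position of a vertex. -/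
def vpos : Λ.Vert q r → ℕ
  | .inl v => v.1.1
  | .inr _ => Λ.a

/-- The digits stored by a vertex. -/
def vlab : Λ.Vert q r → ℕ → ℕ
  | .inl v, τ => if h : τ < d then (v.1.2 ⟨τ, h⟩ : ℕ) else 0
  | .inr _, _ => 0

/-- The pair of words stored by two vertices is accepted by `x`. -/
def Accepts (x : (Fin d → Fin q) × (Fin d → Fin q) → Bool) : Λ.Vert q r → Λ.Vert q r → Prop
  | .inl u, .inl v => x (u.1.2, v.1.2) = true
  | _, _ => False

variable (Λ r) in
/-- The graph in which an induced path spells out a pair of words accepted by `x` and `y`. -/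
def wordGraph (x y : (Fin d → Fin q) × (Fin d → Fin q) → Bool) : SimpleGraph (Λ.Vert q r) :=
  Λ.graph vpos vlab (Accepts x) (Accepts y)

lemma vpos_lt (v : Λ.Vert q r) : vpos v < k := by
  have := Λ.a_lt
  rcases v with v | v
  · exact v.1.1.2
  · simp only [vpos]; omega

/-- Unstored digits are `0`, so a core vertex is determined by its position and its stored digits.
Position `a` is left out because the padding vertices there all carry the label `0`. -/
lemma vlab_separates (u v : Λ.Vert q r) (h : vpos u = vpos v) (ha : vpos u ≠ Λ.a) (hne : u ≠ v) :
    ∃ τ, Λ.mask (vpos u) τ ∧ vlab u τ ≠ vlab v τ := by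
  rcases u with u | u
  swap
  · exact absurd rfl ha
  rcases v with v | v
  swap
  · exact absurd h ha
  by_contra! hcon
  apply hne
  congr 1
  have hp : u.1.1 = v.1.1 := Fin.ext h
  refine Subtype.ext (Prod.ext hp (funext fun τ => Fin.ext ?_))
  by_cases hτ : Λ.mask (vpos (Sum.inl u : Λ.Vert q r)) τ
  · simpa [vlab] using hcon τ hτ
  · rw [u.2 τ hτ, v.2 τ (by rw [← hp]; exact hτ)]

/-- A path would spell one pair accepted on both sides. Padding cannot take part in it, since
`Accepts` is false on padding vertices. -/
theorem pathFree_wordGraph {x y : (Fin d → Fin q) × (Fin d → Fin q) → Bool}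
    (h : ∀ i, ¬ (x i = true ∧ y i = true)) : PathFree k (Λ.wordGraph r x y) := by
  by_contra hcon
  obtain ⟨f, hf⟩ := exists_isInducedPath (by have := Λ.one_lt; omega) hcon
  obtain ⟨u, v, u', v', -, -, -, -, hX, hY, h1, h2⟩ :=
    exists_common_pair (Λ := Λ) vpos_lt vlab_separates hf
  rcases u with u | u
  swap
  · exact hX.elim
  rcases v with v | v
  swap
  · exact hX.elim
  rcases u' with u' | u'
  swap
  · exact hY.elim
  rcases v' with v' | v'
  swap
  · exact hY.elim
  have e1 : u.1.2 = u'.1.2 := funext fun τ => Fin.ext (by simpa [vlab] using h1 τ τ.2)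
  have e2 : v.1.2 = v'.1.2 := funext fun τ => Fin.ext (by simpa [vlab] using h2 τ τ.2)
  refine h (u.1.2, v.1.2) ⟨hX, ?_⟩
  rw [e1, e2]
  exact hY

open Classical in
/-- The vertex at the position `p` that stores digits of the given words. -/
noncomputable def spell (w w' : Fin d → Fin q) (hq : 0 < q) (p : ℕ) : Λ.Vert q r :=
  .inl ⟨(⟨min p (k - 1), by have := Λ.one_lt; omega⟩, fun τ =>
    if Λ.mask (min p (k - 1)) τ then (if Λ.typ (min p (k - 1)) then w' τ else w τ) else ⟨0, hq⟩),
    fun τ hτ => by simp only at hτ; simp [hτ]⟩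

lemma vpos_spell {w w' : Fin d → Fin q} {hq : 0 < q} {p : ℕ} (hp : p < k) :
    vpos (spell w w' hq p : Λ.Vert q r) = p := by
  simp only [spell, vpos]
  omega

lemma connected_wordGraph (hq : 0 < q) (x y : (Fin d → Fin q) × (Fin d → Fin q) → Bool) :
    (Λ.wordGraph r x y).Connected :=
  graph_connected (g := spell (fun _ => ⟨0, hq⟩) (fun _ => ⟨0, hq⟩) hq) (fun _ => vpos_spell)
    vpos_lt

theorem not_pathFree_wordGraph {x y : (Fin d → Fin q) × (Fin d → Fin q) → Bool} (hq : 0 < q)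
    {i : (Fin d → Fin q) × (Fin d → Fin q)} (hx : x i = true) (hy : y i = true) :
    ¬ PathFree k (Λ.wordGraph r x y) := by
  classical
  obtain ⟨w, w'⟩ := i
  have ha := Λ.a_lt
  have hb := Λ.b_lt
  have hmin : ∀ p < k, min p (k - 1) = p := fun p hp => by omega
  have hl : ∀ τ : Fin d, (Λ.mask Λ.a τ ∧ Λ.typ Λ.a = false) ∧ (Λ.mask Λ.b τ ∧ Λ.typ Λ.b = false) := by
    intro τ
    obtain ⟨c, c0, c1, hc⟩ := Λ.chain τ τ.2 false
    simp only [Bool.false_eq_true, if_false] at c0 c1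
    have h0 := hc 0 (by omega)
    have h1 := hc (m + 1) le_rfl
    rw [c0] at h0
    rw [c1] at h1
    exact ⟨⟨h0.2.1, h0.2.2.1⟩, h1.2.1, h1.2.2.1⟩
  have hr : ∀ τ : Fin d, (Λ.mask (Λ.a + 2) τ ∧ Λ.typ (Λ.a + 2) = true) ∧
      (Λ.mask (Λ.b + 2) τ ∧ Λ.typ (Λ.b + 2) = true) := by
    intro τ
    obtain ⟨c, c0, c1, hc⟩ := Λ.chain τ τ.2 true
    simp only [if_true] at c0 c1
    have h0 := hc 0 (by omega)
    have h1 := hc (m + 1) le_rfl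
    rw [c0] at h0
    rw [c1] at h1
    exact ⟨⟨h0.2.1, h0.2.2.1⟩, h1.2.1, h1.2.2.1⟩
  refine not_pathFree_of_isInducedPath (f := spell w w' hq)
    (isInducedPath_of_consistent (fun _ => vpos_spell) ?_ ?_ ?_)
  · intro p hp p' hp' ht τ h1 h2
    simp only [spell, vlab]
    split_ifs <;> simp_all
  · simp only [spell, Accepts]
    refine Eq.trans (congrArg x (Prod.ext ?_ ?_)) hx
    · funext τ
      simp [hmin Λ.a (by omega), (hl τ).1.1, (hl τ).1.2]
    · funext τ
      simp [hmin (Λ.a + 2) (by omega), (hr τ).1.1, (hr τ).1.2]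
  · simp only [spell, Accepts]
    refine Eq.trans (congrArg y (Prod.ext ?_ ?_)) hy
    · funext τ
      simp [hmin Λ.b (by omega), (hl τ).2.1, (hl τ).2.2]
    · funext τ
      simp [hmin (Λ.b + 2) (by omega), (hr τ).2.1, (hr τ).2.2]

variable (Λ q) in
lemma card_core_le : Fintype.card (Λ.Core q) ≤ k * q ^ d := by
  have := Fintype.card_le_of_injective (fun v : Λ.Core q => v.1) Subtype.val_injective
  simpa using this

/-- There are few vertices at positions that store at most one digit. -/
lemma card_subtype_le (hq : 0 < q) (p : Λ.Vert q r → Prop)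
    [Fintype {v // p v}] (hp : ∀ v, p v → v.isLeft ∧
      ∀ τ < d, ∀ τ' < d, Λ.mask (vpos v) τ → Λ.mask (vpos v) τ' → τ = τ') :
    Fintype.card {v // p v} ≤ k * q := by
  classical
  -- The one digit stored at position `n`; the default `0` is irrelevant, as vertices at a position
  -- without digits are determined by the position.
  let τ₀ : ℕ → ℕ := fun n => if h : ∃ τ < d, Λ.mask n τ then h.choose else 0
  have hlab : ∀ (v : Λ.Vert q r) τ, vlab v τ < q := by
    rintro (v | v) τ
    · simp only [vlab]
      split_ifs
      · exact Fin.is_lt _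
      · exact hq
    · exact hq
  let F : {v // p v} → Fin k × Fin q := fun v =>
    (⟨vpos v.1, vpos_lt _⟩, ⟨vlab v.1 (τ₀ (vpos v.1)), hlab _ _⟩)
  have hF : Function.Injective F := by
    rintro ⟨u, hu⟩ ⟨v, hv⟩ h
    simp only [F, Prod.mk.injEq, Fin.mk.injEq] at h
    obtain ⟨h1, h2⟩ := h
    obtain ⟨hul, hu'⟩ := hp u hu
    obtain ⟨hvl, -⟩ := hp v hv
    rcases u with u | u
    swap
    · simp at hul
    rcases v with v | v
    swap
    · simp at hvl
    have hpos : u.1.1 = v.1.1 := Fin.ext h1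
    congr 2
    refine Subtype.ext (Prod.ext hpos (funext fun τ => Fin.ext ?_))
    by_cases hτ : Λ.mask (vpos (Sum.inl u : Λ.Vert q r)) τ
    · have hex : ∃ τ < d, Λ.mask (vpos (Sum.inl u : Λ.Vert q r)) τ := ⟨τ, τ.2, hτ⟩
      have e : τ₀ (vpos (Sum.inl u : Λ.Vert q r)) = τ := by
        simp only [τ₀, dif_pos hex]
        exact hu' _ hex.choose_spec.1 _ τ.2 hex.choose_spec.2 hτ
      rw [← h1, e] at h2
      simpa [vlab] using h2
    · rw [u.2 τ hτ, v.2 τ (by rw [← hpos]; exact hτ)]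
  simpa using Fintype.card_le_of_injective F hF

lemma wordGraph_adj_congr {x x' y y' : (Fin d → Fin q) × (Fin d → Fin q) → Bool}
    {u v : Λ.Vert q r}
    (hx : x = x' ∨ (vpos u ≠ Λ.a ∧ vpos v ≠ Λ.a))
    (hy : y = y' ∨ (vpos u ≠ Λ.b + 2 ∧ vpos v ≠ Λ.b + 2)) :
    (Λ.wordGraph r x y).Adj u v ↔ (Λ.wordGraph r x' y').Adj u v := by
  have key : ∀ (u v : Λ.Vert q r), (x = x' ∨ (vpos u ≠ Λ.a ∧ vpos v ≠ Λ.a)) →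
      (y = y' ∨ (vpos u ≠ Λ.b + 2 ∧ vpos v ≠ Λ.b + 2)) →
      (Λ.Forbidden vpos (Accepts x) (Accepts y) u v ↔
        Λ.Forbidden vpos (Accepts x') (Accepts y') u v) := by
    intro u v hx hy
    unfold Forbidden
    refine or_congr ?_ ?_
    · rcases hx with rfl | hx
      · rfl
      · constructor <;> exact fun h => absurd h.1 hx.1
    · rcases hy with rfl | hy
      · rfl
      · constructor <;> exact fun h => absurd h.2.1 hy.2
  have h1 := key u v hx hy
  have h2 := key v u (hx.imp id And.symm) (hy.imp id And.symm)
  simp only [wordGraph, graph, h1, h2]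

end Layout

/-! ### A potential between the two sides -/

section Potential

variable {m E p : ℕ}

/-- For words of one digit, the type refines the coordinate. -/
lemma slot_step_single_digit (hp : p + 1 < E + 7 + 2 * m) :
    2 * (slot m E p).lam + (slot m E p).typ.toNat ≤
      2 * (slot m E (p + 1)).lam + (slot m E (p + 1)).typ.toNat + 2 ∧
    2 * (slot m E (p + 1)).lam + (slot m E (p + 1)).typ.toNat ≤
      2 * (slot m E p).lam + (slot m E p).typ.toNat + 2 := by
  rcases place m E p with h | h | h | h | ⟨s, hs, h⟩ | h | h | h | h | ⟨t, s, hs, h⟩ | ⟨t, h⟩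
  · rcases Nat.lt_or_ge (p + 1) E with h' | h'
    · rw [slot_pendant h, slot_pendant h']; simp
    · rw [slot_pendant h, slot_left_one (by omega)]; simp
  · rw [slot_left_one h, slot_left_hub (by omega)]; simp
  · rw [slot_left_hub h, slot_left_two (by omega)]; simp
  · rcases Nat.eq_zero_or_pos m with rfl | hm
    · rw [slot_left_two h, slot_right_one (by omega)]; simp
    · rw [slot_left_two h, slot_firstRun (s := 0) (by omega) (by omega)]; simp [firstRunSlot]
  · rcases Nat.lt_or_ge (s + 1) (2 * m) with h' | h'
    · rw [slot_firstRun hs h, slot_firstRun (s := s + 1) h' (by omega)]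
      rcases Nat.mod_two_eq_zero_or_one s with e | e <;> simp [firstRunSlot, e, Nat.add_mod] <;>
        omega
    · have e : s % 2 = 1 := by omega
      rw [slot_firstRun hs h, slot_right_one (by omega)]
      simp [firstRunSlot, e]; omega
  · rw [slot_right_one h, slot_right_hub (by omega)]; simp
  · rw [slot_right_hub h, slot_right_two (by omega)]; simp; omega
  · rw [slot_right_two h, slot_turn (by omega)]; simp; omega
  · omega
  · have := le_runStart (m := m) (E := E) t
    omega
  · have := le_runStart (m := m) (E := E) t
    omega

/-- Away from both sides, a position stores at most one digit. -/
lemma slot_mask_subsingleton (h0 : 0 < (slot m E p).lam) (h1 : (slot m E p).lam < m + 1) {τ τ' : ℕ}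
    (hτ : (slot m E p).mask τ) (hτ' : (slot m E p).mask τ') : τ = τ' := by
  rcases place m E p with h | h | h | h | ⟨s, hs, h⟩ | h | h | h | h | ⟨t, s, hs, h⟩ | ⟨t, h⟩
  · rw [slot_pendant h] at hτ; exact hτ.elim
  · rw [slot_left_one h] at h0; exact absurd h0 (lt_irrefl _)
  · rw [slot_left_hub h] at hτ; exact hτ.elim
  · rw [slot_left_two h] at h0; exact absurd h0 (lt_irrefl _)
  · rw [slot_firstRun hs h] at hτ hτ'; exact hτ.trans hτ'.symm
  · rw [slot_right_one h] at h1; exact absurd h1 (lt_irrefl _)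
  · rw [slot_right_hub h] at hτ; exact hτ.elim
  · rw [slot_right_two h] at h1; exact absurd h1 (lt_irrefl _)
  · rw [slot_turn h] at hτ; exact hτ.elim
  · rw [slot_run hs.le h, runSlot_of_lt hs] at hτ hτ'; exact hτ.trans hτ'.symm
  · rw [slot_hub h] at hτ; exact hτ.elim

end Potential

section Lipschitz

variable {m E D q r : ℕ} {hm : 0 < m} {hE : 0 < E}
  {x y : (Fin (D + 1) → Fin q) × (Fin (D + 1) → Fin q) → Bool}
  {u v : (pathLayout m E D hm hE).Vert q r}

open Layout

/-- The hypotheses treat the kinds of edges in turn: consecutive positions, conflicts, and forbidden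
pairs on either side. -/
lemma lipschitz_of_step {w : ℕ → ℕ}
    (hstep : ∀ p, p + 1 < runStart m E D → w p ≤ w (p + 1) + 2 ∧ w (p + 1) ≤ w p + 2)
    (hconf : ∀ p p', (slot m E p).typ = (slot m E p').typ →
      (slot m E p).lam ≤ (slot m E p').lam + 1 → w p ≤ w p' + 2)
    (hleft : w E ≤ w (E + 2) + 2 ∧ w (E + 2) ≤ w E + 2)
    (hright : w (E + 3 + 2 * m) ≤ w (E + 3 + 2 * m + 2) + 2 ∧
      w (E + 3 + 2 * m + 2) ≤ w (E + 3 + 2 * m) + 2)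
    (h : ((pathLayout m E D hm hE).wordGraph r x y).Adj u v) : w (vpos u) ≤ w (vpos v) + 2 := by
  have hu := vpos_lt u
  have hv := vpos_lt v
  obtain ⟨-, h | h | h | h | h | h⟩ := h
  · rw [h]; omega
  · have := hstep (vpos u) (by omega)
    rw [h] at this; exact this.1
  · have := hstep (vpos v) (by omega)
    rw [h] at this; exact this.2
  · exact hconf _ _ h.1 h.2.1
  · rcases h with ⟨h1, h2, -⟩ | ⟨h1, h2, -⟩
    · rw [h1, h2]; exact hleft.1
    · rw [h1, h2]; exact hright.1
  · rcases h with ⟨h1, h2, -⟩ | ⟨h1, h2, -⟩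
    · rw [h1, h2]; exact hleft.2
    · rw [h1, h2]; exact hright.2

lemma lipschitz_lam (h : ((pathLayout m E D hm hE).wordGraph r x y).Adj u v) :
    2 * (slot m E (vpos u)).lam ≤ 2 * (slot m E (vpos v)).lam + 2 := by
  refine lipschitz_of_step (w := fun p => 2 * (slot m E p).lam) (fun p _ => ?_)
    (fun p p' _ h => by omega) ?_ ?_ h
  · have := (slot_step (E := E) hm p).2.2.2
    omega
  · simp [slot_left_one rfl, slot_left_two rfl]
  · simp [slot_right_one rfl, slot_right_two (show E + 3 + 2 * m + 2 = E + 5 + 2 * m by omega)]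

end Lipschitz

section SingleDigit

variable {m E q r : ℕ} {hm : 0 < m} {hE : 0 < E}
  {x y : (Fin 1 → Fin q) × (Fin 1 → Fin q) → Bool} {u v : (pathLayout m E 0 hm hE).Vert q r}

open Layout

lemma lipschitz_lam_typ (h : ((pathLayout m E 0 hm hE).wordGraph r x y).Adj u v) :
    2 * (slot m E (vpos u)).lam + (slot m E (vpos u)).typ.toNat ≤
      2 * (slot m E (vpos v)).lam + (slot m E (vpos v)).typ.toNat + 2 := by
  refine lipschitz_of_step (D := 0)
    (w := fun p => 2 * (slot m E p).lam + (slot m E p).typ.toNat) (fun p hp => ?_)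
    (fun p p' h1 h2 => by simp only [h1]; omega) ?_ ?_ h
  · exact slot_step_single_digit (by simpa [runStart] using hp)
  · simp [slot_left_one rfl, slot_left_two rfl]
  · simp [slot_right_one rfl, slot_right_two (show E + 3 + 2 * m + 2 = E + 5 + 2 * m by omega)]
    omega

end SingleDigit

/-! ### Counting -/

section Count

open Layout

/-- The lower bound on the certificates, for a fixed alphabet of digits. -/
theorem words_le_of_hasPLS {m E D q n M s ℓ : ℕ} (hm : 0 < m) (hE : 0 < E) (hq : 0 < q)
    (hℓ : (1 ≤ D ∧ m = 2 * ℓ) ∨ (D = 0 ∧ m + 1 = 2 * ℓ))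
    (hn : runStart m E D * q ^ (D + 1) ≤ n) (hM : n ≤ M)
    (h : HasPLS (fun _ G => PathFree (runStart m E D) G) ℓ n M s) :
    q ^ (D + 1) * q ^ (D + 1) ≤ s * (runStart m E D * q) := by
  classical
  set Λ := pathLayout m E D hm hE with hΛ
  set r := n - Fintype.card (Λ.Core q) with hr
  have hcard : Fintype.card (Λ.Vert q r) = n := by
    have := Λ.card_core_le q
    rw [Fintype.card_sum, Fintype.card_fin]
    -- By `hn` the core has at most `n` vertices, so the truncated subtraction defining `r` is
    -- exact.
    omega
  rw [← hcard] at h hM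
  have hι : Fintype.card ((Fin (D + 1) → Fin q) × (Fin (D + 1) → Fin q)) =
      q ^ (D + 1) * q ^ (D + 1) := by simp
  have main : ∀ (w : ℕ → ℕ) (hi : ℕ), 4 * ℓ < hi →
      (∀ x y (u v : Λ.Vert q r), (Λ.wordGraph r x y).Adj u v → w (vpos u) ≤ w (vpos v) + 2) →
      w E = 0 → hi ≤ w (E + 5 + 2 * m) →
      (∀ p, 0 < w p → w p < hi → ∀ τ < D + 1, ∀ τ' < D + 1, (slot m E p).mask τ →
        (slot m E p).mask τ' → τ = τ') →
      q ^ (D + 1) * q ^ (D + 1) ≤ s * (runStart m E D * q) := by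
    intro w hi hlt hlip hwa hwb hmask
    have h1 := card_le_of_hasPLS (P := fun _ G => PathFree (runStart m E D) G)
      (fun x y => Λ.wordGraph r x y) (fun v => w (vpos v))
      (lo := 0) (hi := hi) (ℓ := ℓ) (M := M) (s := s) (by omega) hlip
      (fun x x' y u v hu hv => wordGraph_adj_congr
        (.inr ⟨fun e => by rw [e] at hu; exact absurd hwa hu.ne',
          fun e => by rw [e] at hv; exact absurd hwa hv.ne'⟩) (.inl rfl))
      (fun x y y' u v hu hv => wordGraph_adj_congr (.inl rfl)
        (.inr ⟨fun e => ?_, fun e => ?_⟩))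
      (fun x y => connected_wordGraph hq x y)
      (fun x => pathFree_wordGraph fun i => by simp)
      (fun x y i hx hy => not_pathFree_wordGraph hq hx hy) hM h
    · rw [hι] at h1
      refine h1.trans (Nat.mul_le_mul_left _ (card_subtype_le hq _ ?_))
      rintro v ⟨hv1, hv2⟩
      refine ⟨?_, hmask _ hv1 hv2⟩
      rcases v with v | v
      · rfl
      · exact absurd hwa hv1.ne'
    · rw [e] at hu
      have e' : Λ.b + 2 = E + 5 + 2 * m := by simp [hΛ, pathLayout]; omega
      rw [e'] at hu
      omega
    · rw [e] at hv
      have e' : Λ.b + 2 = E + 5 + 2 * m := by simp [hΛ, pathLayout]; omega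
      rw [e'] at hv
      omega
  rcases hℓ with ⟨hD, hℓ⟩ | ⟨rfl, hℓ⟩
  -- Width `2 * (m + 1) = 4 * ℓ + 2`; strictly between the sides a position stores at most one
  -- digit.
  · refine main (fun p => 2 * (slot m E p).lam) (2 * (m + 1)) (by omega)
      (fun x y u v => lipschitz_lam) (by simp [slot_left_one rfl])
      (by simp [slot_right_two rfl]) ?_
    intro p h0 h1 τ _ τ' _ h2 h3
    exact slot_mask_subsingleton (by omega) (by omega) h2 h3
  -- With a single digit even the full words are cheap, so the separator may include vertices of
  -- both sides. Since `y` matters only for pairs involving `b + 2`, whose type is `true`, the width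
  -- is `2 * m + 3 = 4 * ℓ + 1`, and `m` can be one smaller.
  · refine main (fun p => 2 * (slot m E p).lam + (slot m E p).typ.toNat) (2 * (m + 1) + 1) (by omega)
      (fun x y u v => lipschitz_lam_typ) (by simp [slot_left_one rfl])
      (by simp [slot_right_two rfl]) ?_
    intro p _ _ τ h2 τ' h3 _ _
    omega

/-- Take the largest `q` with `k * q ^ d ≤ n` and use `q + 1 ≤ 2 * q`. -/
lemma exists_alphabet {k n : ℕ} (d : ℕ) (hk : 0 < k) (hd : 0 < d) (hn : k ≤ n) :
    ∃ q, 0 < q ∧ k * q ^ d ≤ n ∧ n ≤ k * (2 * q) ^ d := by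
  classical
  have hex : ∃ q, n < k * (q + 1) ^ d := by
    refine ⟨n, ?_⟩
    calc n < n + 1 := Nat.lt_succ_self n
      _ ≤ (n + 1) ^ d := Nat.le_self_pow hd.ne' _
      _ ≤ k * (n + 1) ^ d := Nat.le_mul_of_pos_left _ hk
  have h1 := Nat.find_spec hex
  have h0 : 0 < Nat.find hex := by
    rw [Nat.pos_iff_ne_zero]
    intro h
    rw [h] at h1
    simp at h1
    omega
  refine ⟨Nat.find hex, h0, ?_, ?_⟩
  · have := Nat.find_min hex (m := Nat.find hex - 1) (by omega)
    rw [Nat.sub_add_cancel h0] at this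
    omega
  · refine h1.le.trans ?_
    gcongr
    omega

theorem requiresCertificateSize_of_words {ℓ d k : ℕ} (hd : 0 < d) (hk : 0 < k)
    (h : ∀ q n M s : ℕ, 0 < q → k * q ^ d ≤ n → n ≤ M →
      HasPLS (fun _ G => PathFree k G) ℓ n M s → q ^ d * q ^ d ≤ s * (k * q)) :
    RequiresCertificateSize (fun _ G => PathFree k G) ℓ
      (fun n => (n : ℝ) ^ (2 - 1 / (d : ℝ))) := by
  have hk' : (0 : ℝ) < k := by exact_mod_cast hk
  -- With `z = n ^ (1 / d)`, the constant comes from `z ≤ 2 * k * q` and `q ^ (2 * d - 1) ≤ s * k`.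
  -- No power of the logarithm is needed.
  refine ⟨1 / ((2 * k) ^ (2 * d - 1) * k), by positivity, 0, ?_⟩
  filter_upwards [Filter.eventually_ge_atTop k] with n hn M hM s hs
  obtain ⟨q, hq, h1, h2⟩ := exists_alphabet d hk hd hn
  have h3 := h q n M s hq h1 hM hs
  have hq' : (0 : ℝ) < q := by exact_mod_cast hq
  have hsq : (q : ℝ) ^ (2 * d - 1) ≤ s * k := by
    have h4 : (q : ℝ) ^ (2 * d - 1) * q ≤ s * k * q := by
      rw [← pow_succ, show 2 * d - 1 + 1 = d + d by omega, pow_add, mul_assoc]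
      exact_mod_cast h3
    exact le_of_mul_le_mul_right h4 hq'
  set z : ℝ := (n : ℝ) ^ (1 / (d : ℝ)) with hz
  have hz0 : 0 ≤ z := by positivity
  have hd' : (d : ℝ) ≠ 0 := by exact_mod_cast hd.ne'
  have hzd : z ^ d = n := by
    rw [hz, ← Real.rpow_natCast, ← Real.rpow_mul (Nat.cast_nonneg n), one_div,
      inv_mul_cancel₀ hd', Real.rpow_one]
  have hzpow : (n : ℝ) ^ (2 - 1 / (d : ℝ)) = z ^ (2 * d - 1) := by
    rw [hz, ← Real.rpow_natCast, ← Real.rpow_mul (Nat.cast_nonneg n)]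
    congr 1
    rw [Nat.cast_sub (by omega)]
    push_cast
    field_simp
  have hzq : z ≤ 2 * k * q := by
    refine le_of_pow_le_pow_left₀ hd.ne' (by positivity) ?_
    rw [hzd]
    have h5 : (n : ℝ) ≤ k * (2 * q) ^ d := by exact_mod_cast h2
    have h6 : (k : ℝ) ≤ (k : ℝ) ^ d := le_self_pow₀ (by exact_mod_cast hk) hd.ne'
    calc (n : ℝ) ≤ k * (2 * q) ^ d := h5
      _ ≤ (k : ℝ) ^ d * (2 * q) ^ d := by gcongr
      _ = (2 * k * q) ^ d := by rw [← mul_pow]; ring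
  rw [pow_zero, div_one, hzpow, one_div, inv_mul_le_iff₀ (by positivity)]
  calc z ^ (2 * d - 1) ≤ (2 * k * q) ^ (2 * d - 1) := by gcongr
    _ = (2 * k) ^ (2 * d - 1) * (q : ℝ) ^ (2 * d - 1) := by rw [mul_pow]
    _ ≤ (2 * k) ^ (2 * d - 1) * (s * k) := by gcongr
    _ = (2 * k) ^ (2 * d - 1) * k * s := by ring

theorem requiresCertificateSize_pathFree {ℓ D k m : ℕ} (hm : 0 < m)
    (hℓ : (1 ≤ D ∧ m = 2 * ℓ) ∨ (D = 0 ∧ m + 1 = 2 * ℓ))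
    (hk : 8 + 2 * m + D * (2 * m + 1) ≤ k) :
    RequiresCertificateSize (fun _ G => PathFree k G) ℓ
      (fun n => (n : ℝ) ^ (2 - 1 / ((D + 1 : ℕ) : ℝ))) := by
  -- The initial hubs, at least one of them, absorb the excess of `k`.
  obtain ⟨E, rfl⟩ : ∃ E, k = runStart m (E + 1) D :=
    ⟨k - (8 + 2 * m + D * (2 * m + 1)), by rw [runStart]; omega⟩
  exact requiresCertificateSize_of_words (Nat.succ_pos D) (by omega)
    fun q n M s hq hn hM h => words_le_of_hasPLS hm (Nat.succ_pos E) hq hℓ hn hM h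

end Count

theorem mainTheorem5 (ℓ d k : ℕ) (hℓ : 1 ≤ ℓ) (hd : 1 ≤ d) :
    (d ≤ 2 → 4 * d * ℓ + 7 * d ≤ k →
      RequiresCertificateSize (fun _ G => PathFree k G) ℓ
        (fun n => (n : ℝ) ^ (2 - 1 / (d : ℝ)))) ∧
    (3 ≤ d → 4 * d * ℓ + 4 * d ≤ k →
      RequiresCertificateSize (fun _ G => PathFree k G) ℓ
        (fun n => (n : ℝ) ^ (2 - 1 / (d : ℝ)))) := by
  obtain ⟨D, rfl⟩ : ∃ D, d = D + 1 := ⟨d - 1, by omega⟩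
  constructor
  · intro hd2 hk
    rcases Nat.eq_zero_or_pos D with rfl | hD
    -- The shorter runs are needed: `m = 2 * ℓ` would require `k ≥ 4 * ℓ + 8`, one more than is
    -- given.
    · exact requiresCertificateSize_pathFree (m := 2 * ℓ - 1) (by omega) (.inr ⟨rfl, by omega⟩)
        (by omega)
    · obtain rfl : D = 1 := by omega
      exact requiresCertificateSize_pathFree (m := 2 * ℓ) (by omega) (.inl ⟨hD, rfl⟩) (by omega)
  · intro hd3 hk
    refine requiresCertificateSize_pathFree (m := 2 * ℓ) (by omega) (.inl ⟨by omega, rfl⟩) ?_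
    -- The layout needs `4 * d * ℓ + d + 7` positions, which is at most `4 * d * ℓ + 4 * d` once `d
    -- ≥ 3`.
    nlinarith
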